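/- Let $d$ and $k$ be natural numbers (zero allowed). For a topological space $X$, let $\Omega_k(X)$ be the $k$-th oriented (smooth) bordism group of $X$: its elements are the oriented bordism classes $[M,f]$ of pairs consisting of a closed oriented smooth $k$-manifold $M$ and a continuous map $f\colon M\to X$; addition is disjoint union. For a Hausdorff topological space $T$, let $\operatorname{Sym}^dT=T^d/\mathbb S_d$ be the $d$-th symmetric power with the quotient topology, and let $\operatorname{UConf}_d(T)\subset\operatorname{Sym}^dT$ be the subspace of unordered $d$-tuples of pairwise distinct points. Let $\operatorname{PConf}_d(T)\subset\operatorname{Sym}^{d-1}T\times T$ be the subspace of pairs $(\{x_1,\dots,x_{d-1}\},x)$ such that $x_1,\dots,x_{d-1},x$ are pairwise distinct (it is empty if $d=0$); its elements are configurations of $d$ points with a distinguished point $x$. Let $r\colon\operatorname{PConf}_d(T)\to\operatorname{UConf}_d(T)$, $r(\{x_1,\dots,x_{d-1}\},x)=\{x_1,\dots,x_{d-1},x\}$, be the map that forgets which point is distinguished. For a continuous map $f\colon M\to\operatorname{UConf}_d(T)$ put $$\widetilde M=\{(y,z)\in M\times\operatorname{PConf}_d(T) : f(y)=r(z)\},\qquad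 \widetilde f\colon\widetilde M\to T,\quad \widetilde f(y,z)=\text{the distinguished point of } z .$$ Theorem. For every Hausdorff space $T$ and every closed oriented smooth $k$-manifold $M$ with a continuous map $f\colon M\to\operatorname{UConf}_d(T)$, the space $\widetilde M$ has the structure of a closed oriented smooth $k$-manifold for which the projection $\widetilde M\to M$ is an orientation-preserving local diffeomorphism, and $\widetilde f$ is continuous. There are group homomorphisms $$\operatorname{tr}_T\colon\Omega_k(\operatorname{UConf}_d(T))\to\Omega_k(T),$$ one for every Hausdorff space $T$, such that $\operatorname{tr}_T[M,f]=[\widetilde M,\widetilde f\,]$ for all $(M,f)$, where $\widetilde M$ carries any such structure. They are natural: for every injective continuous map $g\colon T\to T'$ of Hausdorff spaces, with induced map $\operatorname{UConf}_d(g)\colon\operatorname{UConf}_d(T)\to\operatorname{UConf}_d(T')$, one has $g_*\circ\operatorname{tr}_T=\operatorname{tr}_{T'}\circ(\operatorname{UConf}_d(g))_*$. -/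

import Mathlib

open scoped Manifold ContDiff Topology

universe u

noncomputable section

/-! ### Orientations of smooth manifolds -/

section Orientation

variable {E E' E'' : Type*} [NormedAddCommGroup E] [NormedSpace ℝ E]
  [NormedAddCommGroup E'] [NormedSpace ℝ E'] [NormedAddCommGroup E''] [NormedSpace ℝ E'']
  {H H' H'' : Type*} [TopologicalSpace H] [TopologicalSpace H'] [TopologicalSpace H'']

/-- The derivative at `x` of a map between manifolds, as a linear map between the model vector
spaces: tangent vectors at `x` and at `f x` are written in the preferred charts at these points.
(This is `mfderiv`; in Mathlib `TangentSpace I x` is by definition the model vector space.) -/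
def chartDeriv (I : ModelWithCorners ℝ E H) (I' : ModelWithCorners ℝ E' H')
    {M N : Type*} [TopologicalSpace M] [ChartedSpace H M] [TopologicalSpace N] [ChartedSpace H' N]
    (f : M → N) (x : M) : E →L[ℝ] E' :=
  mfderiv I I' f x

/-- An orientation of a manifold: an orientation of every tangent space, locally constant in
charts.

A fixed reference orientation of the model space `E` is carried to the tangent space at `x` by the
preferred chart at `x`. The value `sign x` is `1` if the tangent space at `x` has this orientation
and `-1` if it has the opposite one (for a manifold of dimension zero this is the sign of the
point). Local constancy says that the chart around `x` carries the orientations at all points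
near `x` to the same orientation of `E`. -/
structure ManifoldOrientation (I : ModelWithCorners ℝ E H) (M : Type*) [TopologicalSpace M]
    [ChartedSpace H M] where
  sign : M → ℤˣ
  locallyConstant : ∀ x, ∀ᶠ y in 𝓝 x,
    0 < (sign x * sign y) • (chartDeriv I 𝓘(ℝ, E) (extChartAt I x) y).det

variable {I : ModelWithCorners ℝ E H} {I' : ModelWithCorners ℝ E' H'}
  {I'' : ModelWithCorners ℝ E'' H''}
  {M N P : Type*} [TopologicalSpace M] [ChartedSpace H M] [TopologicalSpace N] [ChartedSpace H' N]
  [TopologicalSpace P] [ChartedSpace H'' P]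

theorem chartDeriv_eq {f : M → N} {x : M} {A : E →L[ℝ] E'} (h : HasMFDerivAt I I' f x A) :
    chartDeriv I I' f x = A := h.mfderiv

theorem chartDeriv_comp {f : M → N} {g : N → P} {x : M} (hg : MDifferentiableAt I' I'' g (f x))
    (hf : MDifferentiableAt I I' f x) :
    chartDeriv I I'' (g ∘ f) x = (chartDeriv I' I'' g (f x)).comp (chartDeriv I I' f x) :=
  mfderiv_comp x hg hf

theorem chartDeriv_extChartAt_self [IsManifold I 1 M] (x : M) :
    chartDeriv I 𝓘(ℝ, E) (extChartAt I x) x = ContinuousLinearMap.id ℝ E :=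
  mfderiv_extChartAt_self

theorem chartDeriv_id (x : M) : chartDeriv I I (fun y : M => y) x = ContinuousLinearMap.id ℝ E :=
  chartDeriv_eq (hasMFDerivAt_id x)

/-- The opposite orientation. -/
def ManifoldOrientation.neg (o : ManifoldOrientation I M) : ManifoldOrientation I M where
  sign x := -o.sign x
  locallyConstant x := by simpa using o.locallyConstant x

section Sum

variable {M' : Type*} [TopologicalSpace M'] [ChartedSpace H M']

theorem mdifferentiableAt_sumInl [IsManifold I 1 M] [IsManifold I 1 M'] (x : M) :
    MDifferentiableAt I I (Sum.inl : M → M ⊕ M') x :=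
  (ContMDiff.inl (n := 1)).mdifferentiableAt one_ne_zero

theorem mdifferentiableAt_sumInr [IsManifold I 1 M] [IsManifold I 1 M'] (x : M') :
    MDifferentiableAt I I (Sum.inr : M' → M ⊕ M') x :=
  (ContMDiff.inr (n := 1)).mdifferentiableAt one_ne_zero

theorem chartDeriv_sumInl [IsManifold I 1 M] [IsManifold I 1 M'] (x : M) :
    chartDeriv I I (Sum.inl : M → M ⊕ M') x = ContinuousLinearMap.id ℝ E := by
  have h2 : MDifferentiableAt I 𝓘(ℝ, E) (extChartAt I (Sum.inl x : M ⊕ M')) (Sum.inl x) :=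
    mdifferentiableAt_extChartAt (mem_chart_source H _)
  have h3 := chartDeriv_comp h2 (mdifferentiableAt_sumInl x)
  have h4 : (extChartAt I (Sum.inl x : M ⊕ M')) ∘ Sum.inl = extChartAt I x := by
    ext y; exact extChartAt_inl_apply
  rw [h4, chartDeriv_extChartAt_self, chartDeriv_extChartAt_self] at h3
  exact h3.symm

theorem chartDeriv_sumInr [IsManifold I 1 M] [IsManifold I 1 M'] (x : M') :
    chartDeriv I I (Sum.inr : M' → M ⊕ M') x = ContinuousLinearMap.id ℝ E := by
  have h2 : MDifferentiableAt I 𝓘(ℝ, E) (extChartAt I (Sum.inr x : M ⊕ M')) (Sum.inr x) :=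
    mdifferentiableAt_extChartAt (mem_chart_source H _)
  have h3 := chartDeriv_comp h2 (mdifferentiableAt_sumInr x)
  have h4 : (extChartAt I (Sum.inr x : M ⊕ M')) ∘ Sum.inr = extChartAt I x := by
    ext y; exact extChartAt_inr_apply
  rw [h4, chartDeriv_extChartAt_self, chartDeriv_extChartAt_self] at h3
  exact h3.symm

theorem chartDeriv_comp_sumInl [IsManifold I 1 M] [IsManifold I 1 M'] {g : M ⊕ M' → N} {x : M}
    (hg : MDifferentiableAt I I' g (Sum.inl x)) :
    chartDeriv I I' g (Sum.inl x) = chartDeriv I I' (g ∘ Sum.inl) x := by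
  rw [chartDeriv_comp hg (mdifferentiableAt_sumInl x), chartDeriv_sumInl]
  rfl

theorem chartDeriv_comp_sumInr [IsManifold I 1 M] [IsManifold I 1 M'] {g : M ⊕ M' → N} {x : M'}
    (hg : MDifferentiableAt I I' g (Sum.inr x)) :
    chartDeriv I I' g (Sum.inr x) = chartDeriv I I' (g ∘ Sum.inr) x := by
  rw [chartDeriv_comp hg (mdifferentiableAt_sumInr x), chartDeriv_sumInr]
  rfl

theorem chartDeriv_sumInl_comp [IsManifold I 1 M] [IsManifold I 1 M'] {g : N → M} {x : N}
    (hg : MDifferentiableAt I' I g x) :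
    chartDeriv I' I ((Sum.inl : M → M ⊕ M') ∘ g) x = chartDeriv I' I g x := by
  rw [chartDeriv_comp (mdifferentiableAt_sumInl _) hg, chartDeriv_sumInl]
  rfl

theorem chartDeriv_sumInr_comp [IsManifold I 1 M] [IsManifold I 1 M'] {g : N → M'} {x : N}
    (hg : MDifferentiableAt I' I g x) :
    chartDeriv I' I ((Sum.inr : M' → M ⊕ M') ∘ g) x = chartDeriv I' I g x := by
  rw [chartDeriv_comp (mdifferentiableAt_sumInr _) hg, chartDeriv_sumInr]
  rfl

/-- The orientation of a disjoint union. -/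
def ManifoldOrientation.sum [IsManifold I 1 M] [IsManifold I 1 M']
    (o : ManifoldOrientation I M) (o' : ManifoldOrientation I M') :
    ManifoldOrientation I (M ⊕ M') where
  sign := Sum.elim o.sign o'.sign
  locallyConstant := by
    rintro (x | x)
    · rw [nhds_inl, Filter.eventually_map]
      filter_upwards [o.locallyConstant x, (chartAt H x).open_source.mem_nhds
        (mem_chart_source H x)] with y hy hy'
      have h : MDifferentiableAt I 𝓘(ℝ, E) (extChartAt I (Sum.inl x : M ⊕ M')) (Sum.inl y) := by
        apply mdifferentiableAt_extChartAt
        rw [ChartedSpace.sum_chartAt_inl]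
        simpa using hy'
      have h4 : (extChartAt I (Sum.inl x : M ⊕ M')) ∘ Sum.inl = extChartAt I x := by
        ext y; exact extChartAt_inl_apply
      rw [chartDeriv_comp_sumInl h, h4]
      exact hy
    · rw [nhds_inr, Filter.eventually_map]
      filter_upwards [o'.locallyConstant x, (chartAt H x).open_source.mem_nhds
        (mem_chart_source H x)] with y hy hy'
      have h : MDifferentiableAt I 𝓘(ℝ, E) (extChartAt I (Sum.inr x : M ⊕ M')) (Sum.inr y) := by
        apply mdifferentiableAt_extChartAt
        rw [ChartedSpace.sum_chartAt_inr]
        simpa using hy'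
      have h4 : (extChartAt I (Sum.inr x : M ⊕ M')) ∘ Sum.inr = extChartAt I x := by
        ext y; exact extChartAt_inr_apply
      rw [chartDeriv_comp_sumInr h, h4]
      exact hy

end Sum

theorem units_smul_mul_pos {a b : ℤˣ} {r s : ℝ} (h : 0 < a • r) (h' : 0 < b • s) :
    0 < (a * b) • (r * s) := by
  have := mul_pos h h'
  rwa [smul_mul_smul_comm] at this

/-- The product orientation. -/
def ManifoldOrientation.prod [FiniteDimensional ℝ E] [FiniteDimensional ℝ E']
    [IsManifold I 1 M] [IsManifold I' 1 N]
    (o : ManifoldOrientation I M) (o' : ManifoldOrientation I' N) :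
    ManifoldOrientation (I.prod I') (M × N) where
  sign z := o.sign z.1 * o'.sign z.2
  locallyConstant := by
    rintro ⟨x, x'⟩
    rw [nhds_prod_eq]
    filter_upwards [((o.locallyConstant x).and ((chartAt H x).open_source.mem_nhds
        (mem_chart_source H x))).prod_mk ((o'.locallyConstant x').and
          ((chartAt H' x').open_source.mem_nhds (mem_chart_source H' x')))]
    rintro ⟨y, y'⟩ ⟨⟨h1, h2⟩, ⟨h3, h4⟩⟩
    have e1 := (mdifferentiableAt_extChartAt (I := I) h2).hasMFDerivAt
    have e2 := (mdifferentiableAt_extChartAt (I := I') h4).hasMFDerivAt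
    have e3 := e1.prodMap (p := (y, y')) e2
    rw [← modelWithCornersSelf_prod] at e3
    have e4 : chartDeriv (I.prod I') 𝓘(ℝ, E × E') (extChartAt (I.prod I') (x, x')) (y, y') =
        (chartDeriv I 𝓘(ℝ, E) (extChartAt I x) y).prodMap
          (chartDeriv I' 𝓘(ℝ, E') (extChartAt I' x') y') := by
      apply chartDeriv_eq
      rw [extChartAt_prod]
      exact e3
    rw [e4]
    have e5 := units_smul_mul_pos h1 h3
    have e6 : ((chartDeriv I 𝓘(ℝ, E) (extChartAt I x) y).prodMap
          (chartDeriv I' 𝓘(ℝ, E') (extChartAt I' x') y')).det =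
        (chartDeriv I 𝓘(ℝ, E) (extChartAt I x) y).det *
          (chartDeriv I' 𝓘(ℝ, E') (extChartAt I' x') y').det :=
      LinearMap.det_prodMap _ _
    rw [e6, mul_mul_mul_comm]
    exact e5

/-- The standard orientation of the unit interval. In Mathlib, the preferred chart at `1` reverses
the direction. -/
def unitIntervalOrientation : ManifoldOrientation (𝓡∂ 1) (Set.Icc (0 : ℝ) 1) where
  sign z := if z.1 < 1 then 1 else -1
  locallyConstant := by
    intro x
    have key : ∀ y : Set.Icc (0 : ℝ) 1, extChartAt (𝓡∂ 1) x = extChartAt (𝓡∂ 1) y →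
        (chartDeriv (𝓡∂ 1) 𝓘(ℝ, EuclideanSpace ℝ (Fin 1)) (extChartAt (𝓡∂ 1) x) y).det = 1 := by
      intro y h
      rw [h, chartDeriv_extChartAt_self]
      exact LinearMap.det_id
    by_cases hx : x.1 < 1
    · have : {y : Set.Icc (0 : ℝ) 1 | y.1 < 1} ∈ 𝓝 x :=
        (isOpen_lt continuous_subtype_val continuous_const).mem_nhds hx
      filter_upwards [this] with y hy
      have hy : y.1 < 1 := hy
      rw [key y (by simp [extChartAt, hx, hy])]
      simp [hx, hy]
    · have : {y : Set.Icc (0 : ℝ) 1 | 0 < y.1} ∈ 𝓝 x :=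
        (isOpen_lt continuous_const continuous_subtype_val).mem_nhds
          (by simp only [Set.mem_ofPred_eq]; linarith)
      filter_upwards [this] with y hy0
      by_cases hy : y.1 < 1
      · have e : (extChartAt (𝓡∂ 1) x : _ → EuclideanSpace ℝ (Fin 1)) =
            (fun v => WithLp.toLp 2 (fun _ => 1) - v) ∘ extChartAt (𝓡∂ 1) y := by
          ext z i
          fin_cases i
          simp [extChartAt, hx, hy, IccLeftChart, IccRightChart]
        have d1 : MDifferentiableAt (𝓡∂ 1) 𝓘(ℝ, EuclideanSpace ℝ (Fin 1))
            (extChartAt (𝓡∂ 1) y) y := mdifferentiableAt_extChartAt (mem_chart_source _ _)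
        have d2 : HasFDerivAt (fun v : EuclideanSpace ℝ (Fin 1) => WithLp.toLp 2 (fun _ => 1) - v)
            (-ContinuousLinearMap.id ℝ _) (extChartAt (𝓡∂ 1) y y) :=
          (hasFDerivAt_id _).const_sub _
        rw [e, chartDeriv_comp d2.hasMFDerivAt.mdifferentiableAt d1,
          chartDeriv_extChartAt_self, chartDeriv_eq d2.hasMFDerivAt]
        have : ((-ContinuousLinearMap.id ℝ (EuclideanSpace ℝ (Fin 1))).comp
          (ContinuousLinearMap.id ℝ (EuclideanSpace ℝ (Fin 1)))).det = -1 := by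
          have := LinearMap.det_smul (-1 : ℝ) (LinearMap.id : EuclideanSpace ℝ (Fin 1) →ₗ[ℝ] _)
          simp at this
          simpa [ContinuousLinearMap.det] using this
        rw [this]
        simp [hx, hy]
      · rw [key y (by simp [extChartAt, hx, hy])]
        simp [hx, hy]

end Orientation

/-! ### Oriented bordism groups -/

section Bordism

/-- The half-space `[0, ∞) × ℝᵏ`, on which `(k + 1)`-dimensional manifolds with boundary are
modelled. -/
abbrev halfSpaceModel (k : ℕ) :
    ModelWithCorners ℝ (EuclideanSpace ℝ (Fin 1) × EuclideanSpace ℝ (Fin k))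
      (ModelProd (EuclideanHalfSpace 1) (EuclideanSpace ℝ (Fin k))) :=
  (𝓡∂ 1).prod (𝓡 k)

/-- The map `(t, v) ↦ t • ν + A v`, where `ν = (-1, 0)` points out of the half-space
`[0, ∞) × ℝᵏ`. -/
def outwardFrame {k : ℕ}
    (A : EuclideanSpace ℝ (Fin k) →L[ℝ] EuclideanSpace ℝ (Fin 1) × EuclideanSpace ℝ (Fin k)) :
    EuclideanSpace ℝ (Fin 1) × EuclideanSpace ℝ (Fin k) →L[ℝ]
      EuclideanSpace ℝ (Fin 1) × EuclideanSpace ℝ (Fin k) :=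
  (-ContinuousLinearMap.inl ℝ _ _).coprod A

/-- The map `j` from an oriented `k`-manifold `M` to the boundary of an oriented `(k + 1)`-manifold
`W` is a local diffeomorphism to the boundary that preserves orientations, where the boundary is
oriented by the rule "outward normal first": an outward vector followed by the image under the
derivative of `j` of a positive basis is a positive basis of the tangent space of `W`. -/
def IsOrientedBoundaryMap {k : ℕ} {M W : Type*} [TopologicalSpace M]
    [ChartedSpace (EuclideanSpace ℝ (Fin k)) M] [TopologicalSpace W]
    [ChartedSpace (ModelProd (EuclideanHalfSpace 1) (EuclideanSpace ℝ (Fin k))) W]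
    (o : ManifoldOrientation (𝓡 k) M) (o' : ManifoldOrientation (halfSpaceModel k) W)
    (j : M → W) : Prop :=
  ∀ x, 0 < (o.sign x * o'.sign (j x)) •
    (outwardFrame (chartDeriv (𝓡 k) (halfSpaceModel k) j x)).det

/-- An oriented singular `k`-manifold in `X`: a closed oriented smooth `k`-manifold `M` with a
continuous map `f : M → X`. Every closed manifold is diffeomorphic to one whose underlying type is
in `Type`. -/
structure OrientedSingularManifold (k : ℕ) (X : Type u) [TopologicalSpace X] extends
    SingularManifold.{0} X ∞ (𝓡 k) where
  [t2Space : T2Space M]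
  orientation : ManifoldOrientation (𝓡 k) M

attribute [instance] OrientedSingularManifold.t2Space

variable {k : ℕ} {X Y : Type*} [TopologicalSpace X] [TopologicalSpace Y]

/-- An oriented bordism between `s` and `t`: a compact oriented smooth `(k + 1)`-manifold `W` with
boundary, a continuous map `F : W → X`, and an orientation-preserving diffeomorphism of the
disjoint union of `s` and `-t` to the boundary of `W`, through which `F` restricts to the maps of
`s` and `t`. (An injective smooth map from a closed manifold which is an immersion is a
diffeomorphism to its image; that `left` and `right` are immersions is part of
`IsOrientedBoundaryMap`.) -/
structure OrientedBordism (s t : OrientedSingularManifold k X) where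
  W : Type
  [topologicalSpace : TopologicalSpace W]
  [chartedSpace : ChartedSpace (ModelProd (EuclideanHalfSpace 1) (EuclideanSpace ℝ (Fin k))) W]
  [isManifold : IsManifold (halfSpaceModel k) ∞ W]
  [compactSpace : CompactSpace W]
  [t2Space : T2Space W]
  orientation : ManifoldOrientation (halfSpaceModel k) W
  F : W → X
  continuous_F : Continuous F
  left : s.M → W
  right : t.M → W
  contMDiff_left : ContMDiff (𝓡 k) (halfSpaceModel k) ∞ left
  contMDiff_right : ContMDiff (𝓡 k) (halfSpaceModel k) ∞ right
  injective : Function.Injective (Sum.elim left right)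
  range_eq : Set.range (Sum.elim left right) = (halfSpaceModel k).boundary W
  F_left : ∀ x, F (left x) = s.f x
  F_right : ∀ x, F (right x) = t.f x
  oriented_left : IsOrientedBoundaryMap s.orientation orientation left
  oriented_right : IsOrientedBoundaryMap t.orientation.neg orientation right

attribute [instance] OrientedBordism.topologicalSpace OrientedBordism.chartedSpace
  OrientedBordism.isManifold OrientedBordism.compactSpace OrientedBordism.t2Space

/-- Two oriented singular manifolds are bordant if there is an oriented bordism between them. -/
def Bordant (s t : OrientedSingularManifold k X) : Prop := Nonempty (OrientedBordism s t)

namespace OrientedSingularManifold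

/-- Disjoint union. -/
def sum (s t : OrientedSingularManifold k X) : OrientedSingularManifold k X where
  __ := s.toSingularManifold.sum t.toSingularManifold
  t2Space := inferInstanceAs (T2Space (s.M ⊕ t.M))
  orientation := s.orientation.sum t.orientation

/-- Reversal of the orientation. -/
def neg (s : OrientedSingularManifold k X) : OrientedSingularManifold k X where
  __ := s.toSingularManifold
  t2Space := s.t2Space
  orientation := s.orientation.neg

variable (k X) in
/-- The empty manifold. -/
def empty : OrientedSingularManifold k X :=
  letI : ChartedSpace (EuclideanSpace ℝ (Fin k)) Empty := ChartedSpace.empty _ _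
  { SingularManifold.empty X Empty (𝓡 k) with
    t2Space := inferInstanceAs (T2Space Empty)
    orientation := ⟨fun x => Empty.elim x, fun x => Empty.elim x⟩ }

instance : IsEmpty (empty k X).M := inferInstanceAs (IsEmpty Empty)

/-- Composition with a continuous map. -/
def map (s : OrientedSingularManifold k X) (g : C(X, Y)) : OrientedSingularManifold k Y where
  __ := s.toSingularManifold.map g.continuous
  t2Space := s.t2Space
  orientation := s.orientation

end OrientedSingularManifold

/-! The facts needed for the group structure on bordism classes. -/

theorem det_outwardFrame_comp
    (A : EuclideanSpace ℝ (Fin k) →L[ℝ] EuclideanSpace ℝ (Fin 1) × EuclideanSpace ℝ (Fin k))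
    (B : EuclideanSpace ℝ (Fin k) →L[ℝ] EuclideanSpace ℝ (Fin k)) :
    (outwardFrame (A.comp B)).det = (outwardFrame A).det * B.det := by
  have h : outwardFrame (A.comp B) =
      (outwardFrame A).comp ((ContinuousLinearMap.id ℝ _).prodMap B) := by
    ext v <;> simp [outwardFrame]
  have h1 : ((outwardFrame A).comp ((ContinuousLinearMap.id ℝ _).prodMap B)).det =
      (outwardFrame A).det * ((ContinuousLinearMap.id ℝ (EuclideanSpace ℝ (Fin 1))).prodMap B).det :=
    LinearMap.det_comp _ _
  have h2 : ((ContinuousLinearMap.id ℝ (EuclideanSpace ℝ (Fin 1))).prodMap B).det =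
      (ContinuousLinearMap.id ℝ (EuclideanSpace ℝ (Fin 1))).det * B.det :=
    LinearMap.det_prodMap _ _
  rw [h, h1, h2]
  simp [ContinuousLinearMap.det]

theorem det_outwardFrame_inr :
    (outwardFrame (ContinuousLinearMap.inr ℝ (EuclideanSpace ℝ (Fin 1))
      (EuclideanSpace ℝ (Fin k)))).det = -1 := by
  have h : outwardFrame (ContinuousLinearMap.inr ℝ (EuclideanSpace ℝ (Fin 1))
      (EuclideanSpace ℝ (Fin k))) = (-ContinuousLinearMap.id ℝ _).prodMap
        (ContinuousLinearMap.id ℝ _) := by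
    ext v <;> simp [outwardFrame]
  have h2 : ((-ContinuousLinearMap.id ℝ (EuclideanSpace ℝ (Fin 1))).prodMap
        (ContinuousLinearMap.id ℝ (EuclideanSpace ℝ (Fin k)))).det =
      (-ContinuousLinearMap.id ℝ (EuclideanSpace ℝ (Fin 1))).det *
        (ContinuousLinearMap.id ℝ (EuclideanSpace ℝ (Fin k))).det :=
    LinearMap.det_prodMap _ _
  have h3 := LinearMap.det_smul (-1 : ℝ) (LinearMap.id : EuclideanSpace ℝ (Fin 1) →ₗ[ℝ] _)
  simp at h3
  rw [h, h2]
  simp [ContinuousLinearMap.det, h3]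

theorem IsOrientedBoundaryMap.sumMap {M M' W W' : Type*} [TopologicalSpace M]
    [ChartedSpace (EuclideanSpace ℝ (Fin k)) M] [IsManifold (𝓡 k) 1 M] [TopologicalSpace M']
    [ChartedSpace (EuclideanSpace ℝ (Fin k)) M'] [IsManifold (𝓡 k) 1 M'] [TopologicalSpace W]
    [ChartedSpace (ModelProd (EuclideanHalfSpace 1) (EuclideanSpace ℝ (Fin k))) W]
    [IsManifold (halfSpaceModel k) 1 W] [TopologicalSpace W']
    [ChartedSpace (ModelProd (EuclideanHalfSpace 1) (EuclideanSpace ℝ (Fin k))) W']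
    [IsManifold (halfSpaceModel k) 1 W']
    {o : ManifoldOrientation (𝓡 k) M} {p : ManifoldOrientation (halfSpaceModel k) W} {j : M → W}
    {o' : ManifoldOrientation (𝓡 k) M'} {p' : ManifoldOrientation (halfSpaceModel k) W'}
    {j' : M' → W'} (h : IsOrientedBoundaryMap o p j) (h' : IsOrientedBoundaryMap o' p' j')
    (hj : ContMDiff (𝓡 k) (halfSpaceModel k) 1 j) (hj' : ContMDiff (𝓡 k) (halfSpaceModel k) 1 j') :
    IsOrientedBoundaryMap (o.sum o') (p.sum p') (Sum.map j j') := by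
  have hd := (hj.sumMap hj').mdifferentiable one_ne_zero
  rintro (x | x)
  · have e : Sum.map j j' ∘ Sum.inl = Sum.inl ∘ j := rfl
    rw [chartDeriv_comp_sumInl (hd _), e,
      chartDeriv_sumInl_comp (hj.mdifferentiable one_ne_zero x)]
    exact h x
  · have e : Sum.map j j' ∘ Sum.inr = Sum.inr ∘ j' := rfl
    rw [chartDeriv_comp_sumInr (hd _), e,
      chartDeriv_sumInr_comp (hj'.mdifferentiable one_ne_zero x)]
    exact h' x

theorem ManifoldOrientation.sum_neg {M M' : Type*} [TopologicalSpace M]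
    [ChartedSpace (EuclideanSpace ℝ (Fin k)) M] [IsManifold (𝓡 k) 1 M] [TopologicalSpace M']
    [ChartedSpace (EuclideanSpace ℝ (Fin k)) M'] [IsManifold (𝓡 k) 1 M']
    (o : ManifoldOrientation (𝓡 k) M) (o' : ManifoldOrientation (𝓡 k) M') :
    (o.sum o').neg = o.neg.sum o'.neg := by
  simp only [ManifoldOrientation.sum, ManifoldOrientation.neg, ManifoldOrientation.mk.injEq]
  funext x
  cases x <;> rfl

theorem Bordant.sum {s t s' t' : OrientedSingularManifold k X} (h : Bordant s t)
    (h' : Bordant s' t') : Bordant (s.sum s') (t.sum t') := by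
  obtain ⟨b⟩ := h
  obtain ⟨c⟩ := h'
  refine ⟨{
    W := b.W ⊕ c.W
    orientation := b.orientation.sum c.orientation
    F := Sum.elim b.F c.F
    continuous_F := b.continuous_F.sumElim c.continuous_F
    left := Sum.map b.left c.left
    right := Sum.map b.right c.right
    contMDiff_left := b.contMDiff_left.sumMap c.contMDiff_left
    contMDiff_right := b.contMDiff_right.sumMap c.contMDiff_right
    injective := ?_
    range_eq := ?_
    F_left := ?_
    F_right := ?_
    oriented_left := b.oriented_left.sumMap c.oriented_left
      (b.contMDiff_left.of_le (by simp)) (c.contMDiff_left.of_le (by simp))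
    oriented_right := ?_ }⟩
  · have hb := b.injective
    have hc := c.injective
    rw [Sum.elim_injective] at hb hc
    refine Sum.elim_injective.2 ⟨Sum.map_injective.2 ⟨hb.1, hc.1⟩, Sum.map_injective.2 ⟨hb.2.1, hc.2.1⟩, ?_⟩
    rintro (x | x) (y | y) h
    · exact hb.2.2 x y (Sum.inl_injective h)
    · cases h
    · cases h
    · exact hc.2.2 x y (Sum.inr_injective h)
  · rw [ModelWithCorners.boundary_disjointUnion, ← b.range_eq, ← c.range_eq]
    ext z
    constructor
    · rintro ⟨((x | x) | (x | x)), rfl⟩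
      · exact Or.inl ⟨_, ⟨Sum.inl x, rfl⟩, rfl⟩
      · exact Or.inr ⟨_, ⟨Sum.inl x, rfl⟩, rfl⟩
      · exact Or.inl ⟨_, ⟨Sum.inr x, rfl⟩, rfl⟩
      · exact Or.inr ⟨_, ⟨Sum.inr x, rfl⟩, rfl⟩
    · rintro (⟨_, ⟨(x | x), rfl⟩, rfl⟩ | ⟨_, ⟨(x | x), rfl⟩, rfl⟩)
      · exact ⟨Sum.inl (Sum.inl x), rfl⟩
      · exact ⟨Sum.inr (Sum.inl x), rfl⟩
      · exact ⟨Sum.inl (Sum.inr x), rfl⟩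
      · exact ⟨Sum.inr (Sum.inr x), rfl⟩
  · rintro (x | x)
    · exact b.F_left x
    · exact c.F_left x
  · rintro (x | x)
    · exact b.F_right x
    · exact c.F_right x
  · have := b.oriented_right.sumMap c.oriented_right
      (b.contMDiff_right.of_le (by simp)) (c.contMDiff_right.of_le (by simp))
    rw [← ManifoldOrientation.sum_neg] at this
    exact this

theorem Bordant.neg {s t : OrientedSingularManifold k X} (h : Bordant s t) :
    Bordant s.neg t.neg := by
  obtain ⟨b⟩ := h
  exact ⟨{
    W := b.W
    orientation := b.orientation.neg
    F := b.F
    continuous_F := b.continuous_F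
    left := b.left
    right := b.right
    contMDiff_left := b.contMDiff_left
    contMDiff_right := b.contMDiff_right
    injective := b.injective
    range_eq := b.range_eq
    F_left := b.F_left
    F_right := b.F_right
    oriented_left := fun x => by
      change 0 < (-s.orientation.sign x * -b.orientation.sign _) • _
      rw [neg_mul_neg]
      exact b.oriented_left x
    oriented_right := fun x => by
      change 0 < (- -t.orientation.sign x * -b.orientation.sign _) • _
      rw [neg_mul_neg]
      exact b.oriented_right x }⟩

theorem Bordant.map {s t : OrientedSingularManifold k X} (h : Bordant s t) (g : C(X, Y)) :
    Bordant (s.map g) (t.map g) := by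
  obtain ⟨b⟩ := h
  exact ⟨{
    W := b.W
    orientation := b.orientation
    F := g ∘ b.F
    continuous_F := g.continuous.comp b.continuous_F
    left := b.left
    right := b.right
    contMDiff_left := b.contMDiff_left
    contMDiff_right := b.contMDiff_right
    injective := b.injective
    range_eq := b.range_eq
    F_left := fun x => congrArg g (b.F_left x)
    F_right := fun x => congrArg g (b.F_right x)
    oriented_left := b.oriented_left
    oriented_right := b.oriented_right }⟩

/-- The maps to the two ends of a cylinder. -/
theorem isOrientedBoundaryMap_cylinder {M N : Type*} [TopologicalSpace M]
    [ChartedSpace (EuclideanSpace ℝ (Fin k)) M] [IsManifold (𝓡 k) 1 M] [TopologicalSpace N]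
    [ChartedSpace (EuclideanSpace ℝ (Fin k)) N]
    (o : ManifoldOrientation (𝓡 k) M) (p : ManifoldOrientation (𝓡 k) N) {g : N → M}
    (hg : MDifferentiable (𝓡 k) (𝓡 k) g) (c : Set.Icc (0 : ℝ) 1)
    (h : ∀ x, 0 < (p.sign x * (unitIntervalOrientation.sign c * o.sign (g x))) •
      (-(chartDeriv (𝓡 k) (𝓡 k) g x).det)) :
    IsOrientedBoundaryMap p (unitIntervalOrientation.prod o) (fun x => (c, g x)) := by
  intro x
  have h1 : chartDeriv (𝓡 k) (halfSpaceModel k) (fun x => (c, g x)) x =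
      (ContinuousLinearMap.inr ℝ _ _).comp (chartDeriv (𝓡 k) (𝓡 k) g x) := by
    have e := (hasMFDerivAt_const (I := 𝓡 k) (I' := 𝓡∂ 1) c x).prodMk (hg x).hasMFDerivAt
    rw [chartDeriv_eq e]
    rfl
  rw [h1, det_outwardFrame_comp, det_outwardFrame_inr, neg_one_mul]
  exact h x

theorem boundary_cylinder {M : Type*} [TopologicalSpace M]
    [ChartedSpace (EuclideanSpace ℝ (Fin k)) M] :
    (halfSpaceModel k).boundary (Set.Icc (0 : ℝ) 1 × M) = {z | z.1 = 0 ∨ z.1 = 1} := by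
  rw [ModelWithCorners.boundary_of_boundaryless_right, boundary_Icc]
  ext z
  exact ⟨fun h => h.1, fun h => ⟨h, trivial⟩⟩

/-- Isomorphic oriented singular manifolds are bordant. -/
theorem Bordant.of_diffeomorph {s t : OrientedSingularManifold k X}
    (φ : t.M ≃ₘ^∞⟮𝓡 k, 𝓡 k⟯ s.M) (hf : ∀ x, s.f (φ x) = t.f x)
    (ho : ∀ x, 0 < (t.orientation.sign x * s.orientation.sign (φ x)) •
      (chartDeriv (𝓡 k) (𝓡 k) φ x).det) : Bordant s t := by
  refine ⟨{
    W := Set.Icc (0 : ℝ) 1 × s.M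
    orientation := unitIntervalOrientation.prod s.orientation
    F := fun z => s.f z.2
    continuous_F := s.hf.comp continuous_snd
    left := fun x => (1, x)
    right := fun x => (0, φ x)
    contMDiff_left := contMDiff_const.prodMk contMDiff_id
    contMDiff_right := contMDiff_const.prodMk φ.contMDiff
    injective := ?_
    range_eq := ?_
    F_left := fun x => rfl
    F_right := hf
    oriented_left := ?_
    oriented_right := ?_ }⟩
  · rw [Sum.elim_injective]
    refine ⟨fun x y h => (Prod.ext_iff.1 h).2, fun x y h => φ.injective (Prod.ext_iff.1 h).2, ?_⟩
    intro x y h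
    exact one_ne_zero (Prod.ext_iff.1 h).1
  · rw [boundary_cylinder]
    ext ⟨c, y⟩
    constructor
    · rintro ⟨(x | x), h⟩
      · exact Or.inr (Prod.ext_iff.1 h).1.symm
      · exact Or.inl (Prod.ext_iff.1 h).1.symm
    · rintro (h | h)
      · exact ⟨Sum.inr (φ.symm y), Prod.ext h.symm (φ.apply_symm_apply y)⟩
      · exact ⟨Sum.inl y, Prod.ext h.symm rfl⟩
  · refine isOrientedBoundaryMap_cylinder (g := fun x => x) _ _ mdifferentiable_id _ fun x => ?_
    rw [chartDeriv_id x]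
    have : (ContinuousLinearMap.id ℝ (EuclideanSpace ℝ (Fin k))).det = 1 := LinearMap.det_id
    rw [this]
    simp [unitIntervalOrientation]
  · refine isOrientedBoundaryMap_cylinder _ _ (φ.mdifferentiable (by simp)) _ fun x => ?_
    simpa [unitIntervalOrientation, ManifoldOrientation.neg] using ho x

theorem bordant_neg_sum_empty (s : OrientedSingularManifold k X) :
    Bordant (s.neg.sum s) (OrientedSingularManifold.empty k X) := by
  have hd : (ContinuousLinearMap.id ℝ (EuclideanSpace ℝ (Fin k))).det = 1 := LinearMap.det_id
  have h0 : ContMDiff (𝓡 k) (halfSpaceModel k) ∞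
      (fun x : s.M => ((0 : Set.Icc (0 : ℝ) 1), x)) := contMDiff_const.prodMk contMDiff_id
  have h1 : ContMDiff (𝓡 k) (halfSpaceModel k) ∞
      (fun x : s.M => ((1 : Set.Icc (0 : ℝ) 1), x)) := contMDiff_const.prodMk contMDiff_id
  have hs : ContMDiff (𝓡 k) (halfSpaceModel k) ∞
      (Sum.elim (fun x : s.M => ((0 : Set.Icc (0 : ℝ) 1), x))
      (fun x : s.M => ((1 : Set.Icc (0 : ℝ) 1), x))) := h0.sumElim h1
  refine ⟨{
    W := Set.Icc (0 : ℝ) 1 × s.M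
    orientation := unitIntervalOrientation.prod s.orientation
    F := fun z => s.f z.2
    continuous_F := s.hf.comp continuous_snd
    left := Sum.elim (fun x : s.M => ((0 : Set.Icc (0 : ℝ) 1), x))
      (fun x : s.M => ((1 : Set.Icc (0 : ℝ) 1), x))
    right := fun x => isEmptyElim x
    contMDiff_left := hs
    contMDiff_right := fun x => isEmptyElim x
    injective := ?_
    range_eq := ?_
    F_left := by rintro (x | x) <;> rfl
    F_right := fun x => isEmptyElim x
    oriented_left := ?_
    oriented_right := fun x => isEmptyElim x }⟩
  · refine Sum.elim_injective.2 ⟨?_, fun x => isEmptyElim x, fun x y => isEmptyElim y⟩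
    refine Sum.elim_injective.2 ⟨fun x y h => (Prod.ext_iff.1 h).2, fun x y h => (Prod.ext_iff.1 h).2, ?_⟩
    intro x y h
    exact zero_ne_one (Prod.ext_iff.1 h).1
  · rw [boundary_cylinder]
    ext ⟨c, y⟩
    constructor
    · rintro ⟨((x | x) | x), h⟩
      · exact Or.inl (Prod.ext_iff.1 h).1.symm
      · exact Or.inr (Prod.ext_iff.1 h).1.symm
      · exact isEmptyElim x
    · rintro (h | h)
      · exact ⟨Sum.inl (Sum.inl y), Prod.ext h.symm rfl⟩
      · exact ⟨Sum.inl (Sum.inr y), Prod.ext h.symm rfl⟩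
  · have e0 : IsOrientedBoundaryMap s.orientation.neg (unitIntervalOrientation.prod s.orientation)
        (fun x : s.M => ((0 : Set.Icc (0 : ℝ) 1), x)) := by
      refine isOrientedBoundaryMap_cylinder (g := fun x => x) _ _ mdifferentiable_id _ fun x => ?_
      rw [chartDeriv_id x, hd]
      simp [unitIntervalOrientation, ManifoldOrientation.neg]
    have e1 : IsOrientedBoundaryMap s.orientation (unitIntervalOrientation.prod s.orientation)
        (fun x : s.M => ((1 : Set.Icc (0 : ℝ) 1), x)) := by
      refine isOrientedBoundaryMap_cylinder (g := fun x => x) _ _ mdifferentiable_id _ fun x => ?_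
      rw [chartDeriv_id x, hd]
      simp [unitIntervalOrientation]
    have hm := hs.mdifferentiable (by simp)
    rintro (x | x)
    · have := e0 x
      have e : chartDeriv (𝓡 k) (halfSpaceModel k) _ (Sum.inl x : s.M ⊕ s.M) = _ :=
        chartDeriv_comp_sumInl (hm (Sum.inl x))
      rw [Sum.elim_comp_inl] at e
      rw [← e] at this
      exact this
    · have := e1 x
      have e : chartDeriv (𝓡 k) (halfSpaceModel k) _ (Sum.inr x : s.M ⊕ s.M) = _ :=
        chartDeriv_comp_sumInr (hm (Sum.inr x))
      rw [Sum.elim_comp_inr] at e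
      rw [← e] at this
      exact this

theorem Bordant.refl (s : OrientedSingularManifold k X) : Bordant s s :=
  Bordant.of_diffeomorph (Diffeomorph.refl (𝓡 k) s.M ∞) (fun _ => rfl) fun x => by
    have : (chartDeriv (𝓡 k) (𝓡 k) (Diffeomorph.refl (𝓡 k) s.M ∞) x) =
      ContinuousLinearMap.id ℝ _ := chartDeriv_id x
    rw [this]
    have hd : (ContinuousLinearMap.id ℝ (EuclideanSpace ℝ (Fin k))).det = 1 := LinearMap.det_id
    rw [hd]
    simp

variable (k X) in
/-- The oriented bordism group `Ω_k(X)`: bordism classes of oriented singular `k`-manifolds in `X`.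
(Bordism is an equivalence relation, so that the equivalence relation generated by it, which
`Quot` uses, is bordism itself.) -/
def OrientedBordismGroup : Type _ := Quot (Bordant : OrientedSingularManifold k X → _ → Prop)

/-- The bordism class of an oriented singular manifold. -/
def bordismClass (s : OrientedSingularManifold k X) : OrientedBordismGroup k X := Quot.mk _ s

theorem det_chartDeriv_pos_of_eq_id {M N : Type*} [TopologicalSpace M]
    [ChartedSpace (EuclideanSpace ℝ (Fin k)) M] [TopologicalSpace N]
    [ChartedSpace (EuclideanSpace ℝ (Fin k)) N] {g : M → N} {x : M} (ε : ℤˣ)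
    (h : chartDeriv (𝓡 k) (𝓡 k) g x = ContinuousLinearMap.id ℝ _) :
    0 < (ε * ε) • (chartDeriv (𝓡 k) (𝓡 k) g x).det := by
  have hd : (ContinuousLinearMap.id ℝ (EuclideanSpace ℝ (Fin k))).det = 1 := LinearMap.det_id
  rw [h, hd]
  simp

theorem bordant_sum_comm (s t : OrientedSingularManifold k X) : Bordant (s.sum t) (t.sum s) := by
  refine Bordant.of_diffeomorph (Diffeomorph.sumComm (𝓡 k) t.M ∞ s.M) ?_ ?_
  · rintro (x | x) <;> rfl
  · have h := (Diffeomorph.sumComm (𝓡 k) t.M ∞ s.M).mdifferentiable (by simp)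
    rintro (x | x)
    · refine det_chartDeriv_pos_of_eq_id (t.orientation.sign x) ?_
      exact (chartDeriv_comp_sumInl (h (Sum.inl x))).trans (chartDeriv_sumInr x)
    · refine det_chartDeriv_pos_of_eq_id (s.orientation.sign x) ?_
      exact (chartDeriv_comp_sumInr (h (Sum.inr x))).trans (chartDeriv_sumInl x)

theorem bordant_sum_assoc (s t r : OrientedSingularManifold k X) :
    Bordant ((s.sum t).sum r) (s.sum (t.sum r)) := by
  refine Bordant.of_diffeomorph (Diffeomorph.sumAssoc (𝓡 k) s.M ∞ t.M r.M).symm ?_ ?_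
  · rintro (x | x | x) <;> rfl
  · have h := (Diffeomorph.sumAssoc (𝓡 k) s.M ∞ t.M r.M).symm.mdifferentiable (by simp)
    rintro (x | x | x)
    · refine det_chartDeriv_pos_of_eq_id (s.orientation.sign x) ?_
      refine (chartDeriv_comp_sumInl (h (Sum.inl x))).trans ?_
      exact (chartDeriv_sumInl_comp (mdifferentiableAt_sumInl x)).trans (chartDeriv_sumInl x)
    · refine det_chartDeriv_pos_of_eq_id (t.orientation.sign x) ?_
      refine (chartDeriv_comp_sumInr (h (Sum.inr (Sum.inl x)))).trans ?_
      refine (chartDeriv_comp_sumInl ((h _).comp _ (mdifferentiableAt_sumInr _))).trans ?_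
      exact (chartDeriv_sumInl_comp (mdifferentiableAt_sumInr x)).trans (chartDeriv_sumInr x)
    · refine det_chartDeriv_pos_of_eq_id (r.orientation.sign x) ?_
      refine (chartDeriv_comp_sumInr (h (Sum.inr (Sum.inr x)))).trans ?_
      refine (chartDeriv_comp_sumInr ((h _).comp _ (mdifferentiableAt_sumInr _))).trans ?_
      exact chartDeriv_sumInr x

theorem bordant_sum_empty (s : OrientedSingularManifold k X) :
    Bordant (s.sum (OrientedSingularManifold.empty k X)) s := by
  refine Bordant.of_diffeomorph (Diffeomorph.sumEmpty (𝓡 k) s.M ∞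
    (M' := (OrientedSingularManifold.empty k X).M)).symm (fun x => rfl) fun x => ?_
  exact det_chartDeriv_pos_of_eq_id (s.orientation.sign x) (chartDeriv_sumInl x)

/-- Addition is disjoint union. -/
instance : Add (OrientedBordismGroup k X) where
  add := Quot.map₂ OrientedSingularManifold.sum
    (fun s _ _ h => (Bordant.refl s).sum h) (fun _ _ t h => h.sum (Bordant.refl t))

/-- Zero is the class of the empty manifold. -/
instance : Zero (OrientedBordismGroup k X) where
  zero := bordismClass (OrientedSingularManifold.empty k X)

/-- The opposite class is given by reversal of the orientation. -/
instance : Neg (OrientedBordismGroup k X) where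
  neg := Quot.map OrientedSingularManifold.neg fun _ _ h => h.neg

instance : AddCommGroup (OrientedBordismGroup k X) where
  add_assoc := by
    rintro ⟨s⟩ ⟨t⟩ ⟨r⟩
    exact Quot.sound (bordant_sum_assoc s t r)
  add_comm := by
    rintro ⟨s⟩ ⟨t⟩
    exact Quot.sound (bordant_sum_comm s t)
  zero_add := by
    rintro ⟨s⟩
    exact (Quot.sound (bordant_sum_comm _ s)).trans (Quot.sound (bordant_sum_empty s))
  add_zero := by
    rintro ⟨s⟩
    exact Quot.sound (bordant_sum_empty s)
  neg_add_cancel := by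
    rintro ⟨s⟩
    exact Quot.sound (bordant_neg_sum_empty s)
  nsmul := nsmulRec
  zsmul := zsmulRec

/-- The homomorphism of bordism groups induced by a continuous map. -/
def bordismMap (k : ℕ) (g : C(X, Y)) : OrientedBordismGroup k X →+ OrientedBordismGroup k Y where
  toFun := Quot.map (fun s => s.map g) fun _ _ h => h.map g
  map_zero' := by
    refine Quot.sound (Bordant.of_diffeomorph (s := OrientedSingularManifold.map _ g)
      (Diffeomorph.refl (𝓡 k) (OrientedSingularManifold.empty k Y).M ∞)
      (fun x => isEmptyElim x) (fun x => isEmptyElim x))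
  map_add' := by
    rintro ⟨s⟩ ⟨t⟩
    refine Quot.sound (Bordant.of_diffeomorph (s := (s.sum t).map g)
      (t := (s.map g).sum (t.map g)) (Diffeomorph.refl (𝓡 k) (s.M ⊕ t.M) ∞) ?_ fun x => ?_)
    · rintro (x | x) <;> rfl
    · exact det_chartDeriv_pos_of_eq_id (M := s.M ⊕ t.M) (N := s.M ⊕ t.M)
        ((s.sum t).orientation.sign x) (chartDeriv_id x)

end Bordism

/-! ### Configuration spaces and tracing -/

section Configurations

variable {T T' : Type*} [TopologicalSpace T] [TopologicalSpace T'] {d k : ℕ}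

/-- The projection from the Cartesian power `Tᵈ` to the symmetric power `Symᵈ T`, which takes
`(x₁, …, x_d)` to the unordered `d`-tuple `{x₁, …, x_d}` (a multiset). Its fibres are the orbits of
the symmetric group. -/
def toSym (x : Fin d → T) : Sym T d := ⟨Finset.univ.val.map x, by simp⟩

/-- The symmetric power has the quotient topology of the Cartesian power. -/
instance : TopologicalSpace (Sym T d) := TopologicalSpace.coinduced toSym inferInstance

variable (T d) in
/-- The unordered configuration space: unordered `d`-tuples of pairwise different points, as a
subspace of the symmetric power. -/
def UConf : Type _ := {c : Sym T d // (c : Multiset T).Nodup}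

instance : TopologicalSpace (UConf T d) :=
  inferInstanceAs (TopologicalSpace {c : Sym T d // (c : Multiset T).Nodup})

variable (T d) in
/-- The space of pointed unordered configurations: the pairs `({x₁, …, x_{d-1}}, x)` in
`Sym^(d-1) T × T` such that `{x₁, …, x_{d-1}, x}` is a configuration of `d` points, as a subspace
of the product. The condition on the cardinality holds automatically for `d ≥ 1`; it makes the
space empty for `d = 0`. -/
def PConf : Type _ :=
  {z : Sym T (d - 1) × T // (z.2 ::ₘ (z.1 : Multiset T)).card = d ∧
    (z.2 ::ₘ (z.1 : Multiset T)).Nodup}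

instance : TopologicalSpace (PConf T d) :=
  inferInstanceAs (TopologicalSpace {z : Sym T (d - 1) × T //
    (z.2 ::ₘ (z.1 : Multiset T)).card = d ∧ (z.2 ::ₘ (z.1 : Multiset T)).Nodup})

/-- The map that forgets which point of a configuration is distinguished. -/
def PConf.forget (z : PConf T d) : UConf T d :=
  ⟨⟨z.1.2 ::ₘ (z.1.1 : Multiset T), z.2.1⟩, z.2.2⟩

/-- The distinguished point. -/
def PConf.point (z : PConf T d) : T := z.1.2

theorem continuous_toSym : Continuous (toSym : (Fin d → T) → Sym T d) := continuous_coinduced_rng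

/-- The map of configuration spaces induced by an injective continuous map. -/
def UConf.map (d : ℕ) (g : C(T, T')) (hg : Function.Injective g) : C(UConf T d, UConf T' d) where
  toFun c := ⟨c.1.map g, c.2.map hg⟩
  continuous_toFun := by
    have h : Continuous (Sym.map g : Sym T d → Sym T' d) := by
      refine continuous_coinduced_dom.2 ?_
      have e : (Sym.map g : Sym T d → Sym T' d) ∘ toSym = toSym ∘ fun x i => g (x i) := by
        ext x
        simp [toSym]
        rfl
      rw [e]
      exact continuous_toSym.comp (by fun_prop)
    exact (h.comp continuous_subtype_val).subtype_mk _

/-- For `s = (M, f : M → UConf_d(T))`, the oriented singular manifold `t` is `(M̃, f̃ : M̃ → T)`: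

* its underlying space is (homeomorphic through `e` to) the pullback `M̃` of the covering
  `PConf_d(T) → UConf_d(T)` by `f`, consisting of the pairs `(y, z)` with `f y = forget z`;
* its smooth structure and orientation are those of the covering, i.e. the projection `M̃ → M` is
  an orientation-preserving local diffeomorphism;
* its map `f̃` takes `(y, z)` to the distinguished point of `z`. -/
def IsTracing (s : OrientedSingularManifold k (UConf T d)) (t : OrientedSingularManifold k T) :
    Prop :=
  ∃ e : t.M ≃ₜ Function.Pullback s.f (PConf.forget : PConf T d → UConf T d),
    IsLocalDiffeomorph (𝓡 k) (𝓡 k) ∞ (fun y => (e y).1.1) ∧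
    (∀ y, 0 < (t.orientation.sign y * s.orientation.sign (e y).1.1) •
      (chartDeriv (𝓡 k) (𝓡 k) (fun y => (e y).1.1) y).det) ∧
    ∀ y, t.f y = (e y).1.2.point

end Configurations

end

noncomputable section

/-! ### The topology of symmetric powers and configuration spaces -/

section Configuration

variable {T : Type*} {d : ℕ}

/-! Forgetting the distinguished point is a finite covering of `UConf T d`, and the transfer is the
passage to the pulled back covering. The quotient by the finite group `S_d` is an open and closed
map, and hence so is the insertion of a point, `Sym^d T × T → Sym^(d+1) T`, of which `PConf.forget`
is a restriction. Having finite fibres, `PConf.forget` is therefore proper; when `T` is Hausdorff it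
is also locally injective, because a distinguished point can be separated from the others. Pulled
back along `f : M → UConf T d`, it gives a local homeomorphism `M̃ → M` with `M̃` compact Hausdorff.
The charts and the orientation of `M` lift to `M̃`, and in the lifted charts the projection is the
identity.

The same construction applies to manifolds with boundary. The covering of a bordism `W` is a bordism
between the coverings of its two ends, since its boundary is exactly the part lying over the
boundary of `W` (`Bordant.tracing`). This makes the transfer well defined on classes.

Any two tracings of `s` are homeomorphic over `s.M`. This homeomorphism is a continuous lift through
a local diffeomorphism, so it is an orientation-preserving diffeomorphism and its cylinder is a
bordism (`IsTracing.bordant`). Additivity and naturality then only require that certain manifolds be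
recognized as tracings (`isTracing_sum`, `isTracing_map`). -/

theorem toSym_eq_iff {x y : Fin d → T} :
    toSym x = toSym y ↔ ∃ σ : Equiv.Perm (Fin d), y ∘ σ = x := by
  classical
  constructor
  · intro h
    have h' : Finset.univ.val.map x = Finset.univ.val.map y := congrArg Subtype.val h
    -- Equal multisets have equal multiplicities, so the fibres of `x` and `y` over each point are
    -- equinumerous; bijections between these fibres glue to the permutation.
    have hcard : ∀ a, Fintype.card {i // x i = a} = Fintype.card {i // y i = a} := by
      intro a
      have := congrArg (Multiset.count a) h'
      rw [Multiset.count_map, Multiset.count_map] at this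
      rw [Fintype.card_subtype, Fintype.card_subtype]
      simpa only [Finset.card_def, Finset.filter_val, eq_comm] using this
    refine ⟨Equiv.ofFiberEquiv (f := x) (g := y)
      fun a => Fintype.equivOfCardEq (hcard a), funext fun i => ?_⟩
    exact Equiv.ofFiberEquiv_map _ i
  · rintro ⟨σ, rfl⟩
    refine Subtype.ext ?_
    change Finset.univ.val.map (y ∘ σ) = Finset.univ.val.map y
    rw [← Multiset.map_map]
    congr 1
    exact congrArg Finset.val (Finset.map_univ_equiv σ)

theorem toSym_surjective : Function.Surjective (toSym : (Fin d → T) → Sym T d) := by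
  rintro ⟨m, hm⟩
  induction m using Quotient.inductionOn with
  | h l =>
    have hl : l.length = d := hm
    subst hl
    refine ⟨l.get, Subtype.ext ?_⟩
    change Finset.univ.val.map l.get = (l : Multiset T)
    rw [Fin.univ_val_map, List.ofFn_get]

/-- The saturation of a set is the union of its translates. The union is finite, so it preserves
closedness as well as openness. -/
theorem preimage_image_toSym (S : Set (Fin d → T)) :
    toSym ⁻¹' (toSym '' S) = ⋃ σ : Equiv.Perm (Fin d), (fun x => x ∘ σ) ⁻¹' S := by
  ext x
  simp only [Set.mem_preimage, Set.mem_image, Set.mem_iUnion]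
  constructor
  · rintro ⟨y, hy, h⟩
    obtain ⟨σ, rfl⟩ := toSym_eq_iff.1 h
    exact ⟨σ, hy⟩
  · rintro ⟨σ, h⟩
    exact ⟨_, h, toSym_eq_iff.2 ⟨σ, rfl⟩⟩

/-- Adding a point to an unordered tuple. -/
def symInsert (z : Sym T d × T) : Sym T (d + 1) := z.2 ::ₛ z.1

theorem symInsert_toSym (x : (Fin d → T) × T) :
    symInsert (Prod.map toSym id x) = toSym (Fin.cons x.2 x.1 : Fin (d + 1) → T) := by
  refine Subtype.ext ?_
  change x.2 ::ₘ Finset.univ.val.map x.1 =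
    Finset.univ.val.map (Fin.cons x.2 x.1 : Fin (d + 1) → T)
  rw [Fin.univ_val_map, Fin.univ_val_map, List.ofFn_succ]
  rfl

/-- Truncated subtraction gives `0 - 1 = 0`, so there is still a distinguished point, and the
cardinality condition fails as `1 = 0`. -/
instance : IsEmpty (PConf T 0) := ⟨fun z => by simpa using z.2.1⟩

/-- A pointed configuration is determined by the configuration and the distinguished point. -/
theorem PConf.ext_forget_point {z w : PConf T d} (h : z.forget = w.forget)
    (h' : z.point = w.point) : z = w := by
  have h1 : z.1.2 ::ₘ (z.1.1 : Multiset T) = w.1.2 ::ₘ (w.1.1 : Multiset T) :=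
    congrArg (fun c : UConf T d => (c.1 : Multiset T)) h
  have h2 : z.1.2 = w.1.2 := h'
  rw [h2, Multiset.cons_inj_right] at h1
  exact Subtype.ext (Prod.ext (Subtype.ext h1) h2)

theorem PConf.point_mem_forget (z : PConf T d) : z.point ∈ (z.forget.1 : Multiset T) :=
  Multiset.mem_cons_self _ _

/-- Together with `PConf.ext_forget_point`, this identifies the fibre of `forget` over `c` with the
set of points of `c`. -/
theorem PConf.exists_forget_eq {c : UConf T d} {x : T} (hx : x ∈ (c.1 : Multiset T)) :
    ∃ z : PConf T d, z.forget = c ∧ z.point = x := by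
  obtain ⟨m, hm⟩ := Multiset.exists_cons_of_mem hx
  have hc : (x ::ₘ m).card = d := hm ▸ c.1.2
  have hm' : m.card = d - 1 := by rw [Multiset.card_cons] at hc; omega
  refine ⟨⟨(⟨m, hm'⟩, x), hc, ?_⟩, Subtype.ext (Subtype.ext hm.symm), rfl⟩
  exact hm ▸ c.2

theorem PConf.finite_fiber (c : UConf T d) : (PConf.forget ⁻¹' {c}).Finite := by
  refine Set.Finite.of_finite_image (f := PConf.point)
    ((Multiset.finite_toSet (c.1 : Multiset T)).subset ?_) ?_
  · rintro _ ⟨z, rfl, rfl⟩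
    exact z.point_mem_forget
  · intro z hz w hw h
    exact PConf.ext_forget_point (hz.trans hw.symm) h

/-- The map of pointed configurations induced by an injective map. -/
def PConf.map {T' : Type*} (g : T → T') (hg : Function.Injective g) (z : PConf T d) :
    PConf T' d :=
  ⟨(z.1.1.map g, g z.1.2), by
    have h : g z.1.2 ::ₘ (z.1.1.map g : Multiset T') = (z.1.2 ::ₘ (z.1.1 : Multiset T)).map g :=
      (Multiset.map_cons g _ _).symm
    rw [h, Multiset.card_map]
    exact ⟨z.2.1, z.2.2.map hg⟩⟩

/-- The pullback thus embeds as a set in `X × T`. This yields its Hausdorff property and most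
injectivity checks below. -/
theorem pullback_ext {X : Type*} {F : X → UConf T d}
    {v w : Function.Pullback F (PConf.forget : PConf T d → UConf T d)}
    (h : v.1.1 = w.1.1) (h' : v.1.2.point = w.1.2.point) : v = w := by
  refine Subtype.ext (Prod.ext h (PConf.ext_forget_point ?_ h'))
  rw [← v.2, ← w.2]
  exact congrArg F h

end Configuration

/-! ### The forgetful map is open, proper and locally injective -/

section ConfigurationTopology

variable {T : Type*} [TopologicalSpace T] {d : ℕ}

theorem isQuotientMap_toSym : Topology.IsQuotientMap (toSym : (Fin d → T) → Sym T d) :=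
  ⟨⟨rfl⟩, toSym_surjective⟩

theorem isOpenMap_toSym : IsOpenMap (toSym : (Fin d → T) → Sym T d) := by
  intro S hS
  rw [← isQuotientMap_toSym.isOpen_preimage, preimage_image_toSym]
  exact isOpen_iUnion fun σ => hS.preimage (by fun_prop)

theorem isClosedMap_toSym : IsClosedMap (toSym : (Fin d → T) → Sym T d) := by
  intro S hS
  rw [← isQuotientMap_toSym.isClosed_preimage, preimage_image_toSym]
  exact isClosed_iUnion_of_finite fun σ => hS.preimage (by fun_prop)

/-- A product of quotient maps need not be a quotient map, but openness survives products. Hence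
maps out of `Sym T d × T` can be tested on Cartesian powers. -/
theorem isOpenQuotientMap_prodMap_toSym :
    IsOpenQuotientMap (Prod.map toSym id : (Fin d → T) × T → Sym T d × T) :=
  IsOpenQuotientMap.prodMap ⟨toSym_surjective, continuous_toSym, isOpenMap_toSym⟩ .id

variable (T d) in
/-- The homeomorphism that splits the first entry off a tuple. -/
def finConsHomeomorph : (Fin d → T) × T ≃ₜ (Fin (d + 1) → T) where
  toFun x := Fin.cons x.2 x.1
  invFun x := (Fin.tail x, x 0)
  left_inv _ := rfl
  right_inv x := Fin.cons_self_tail x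
  continuous_toFun := by
    refine continuous_pi fun i => ?_
    cases i using Fin.cases with
    | zero => exact continuous_snd
    | succ i => exact (continuous_apply i).comp continuous_fst
  continuous_invFun := (continuous_pi fun i => continuous_apply i.succ).prodMk (continuous_apply 0)

theorem symInsert_comp :
    symInsert ∘ (Prod.map toSym id : (Fin d → T) × T → Sym T d × T) =
      toSym ∘ finConsHomeomorph T d :=
  funext symInsert_toSym

theorem continuous_symInsert : Continuous (symInsert : Sym T d × T → Sym T (d + 1)) := by
  rw [isOpenQuotientMap_prodMap_toSym.isQuotientMap.continuous_iff, symInsert_comp]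
  exact continuous_toSym.comp (finConsHomeomorph T d).continuous

/-- On Cartesian powers insertion is a homeomorphism, so images under `symInsert` are computed by a
preimage, a homeomorphism and `toSym`. Openness and closedness of `symInsert` both follow. -/
theorem image_symInsert (S : Set (Sym T d × T)) :
    symInsert '' S = toSym '' (finConsHomeomorph T d '' (Prod.map toSym id ⁻¹' S)) := by
  rw [← Set.image_comp, ← symInsert_comp, Set.image_comp,
    Set.image_preimage_eq _ isOpenQuotientMap_prodMap_toSym.surjective]

theorem isOpenMap_symInsert : IsOpenMap (symInsert : Sym T d × T → Sym T (d + 1)) := by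
  intro S hS
  rw [image_symInsert]
  exact isOpenMap_toSym _ ((finConsHomeomorph T d).isOpenMap _
    (hS.preimage isOpenQuotientMap_prodMap_toSym.continuous))

theorem isClosedMap_symInsert : IsClosedMap (symInsert : Sym T d × T → Sym T (d + 1)) := by
  intro S hS
  rw [image_symInsert]
  exact isClosedMap_toSym _ ((finConsHomeomorph T d).isClosedMap _
    (hS.preimage isOpenQuotientMap_prodMap_toSym.continuous))

variable (T d) in
/-- Pointed configurations of `d + 1` points form the preimage of the configuration space under
the insertion of a point. -/
def PConf.homeomorphPreimage :
    PConf T (d + 1) ≃ₜ (symInsert ⁻¹' {c : Sym T (d + 1) | (c : Multiset T).Nodup} :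
      Set (Sym T d × T)) where
  toFun z := ⟨z.1, z.2.2⟩
  invFun z := ⟨z.1, by simp, z.2⟩
  left_inv _ := rfl
  right_inv _ := rfl
  continuous_toFun := continuous_subtype_val.subtype_mk _
  continuous_invFun := continuous_subtype_val.subtype_mk _

/-- Continuity, openness and closedness all pass to the restriction of a map over a subset of its
target, so `forget` inherits them from `symInsert`. -/
theorem PConf.forget_eq_restrictPreimage :
    (PConf.forget : PConf T (d + 1) → UConf T (d + 1)) =
      Set.restrictPreimage {c : Sym T (d + 1) | (c : Multiset T).Nodup} symInsert ∘
        PConf.homeomorphPreimage T d :=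
  rfl

theorem PConf.continuous_forget : Continuous (PConf.forget : PConf T d → UConf T d) := by
  cases d with
  | zero => exact continuous_of_const fun z => isEmptyElim z
  | succ d =>
    rw [PConf.forget_eq_restrictPreimage]
    exact (continuous_symInsert.restrictPreimage).comp (PConf.homeomorphPreimage T d).continuous

theorem PConf.isOpenMap_forget : IsOpenMap (PConf.forget : PConf T d → UConf T d) := by
  cases d with
  | zero =>
    intro S _
    rw [Set.eq_empty_of_isEmpty S, Set.image_empty]
    exact isOpen_empty
  | succ d =>
    rw [PConf.forget_eq_restrictPreimage]
    exact (isOpenMap_symInsert.restrictPreimage _).comp (PConf.homeomorphPreimage T d).isOpenMap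

theorem PConf.isClosedMap_forget : IsClosedMap (PConf.forget : PConf T d → UConf T d) := by
  cases d with
  | zero =>
    intro S _
    rw [Set.eq_empty_of_isEmpty S, Set.image_empty]
    exact isClosed_empty
  | succ d =>
    rw [PConf.forget_eq_restrictPreimage]
    exact (isClosedMap_symInsert.restrictPreimage _).comp
      (PConf.homeomorphPreimage T d).isClosedMap

theorem PConf.continuous_point : Continuous (PConf.point : PConf T d → T) :=
  continuous_snd.comp continuous_subtype_val

theorem PConf.isProperMap_forget : IsProperMap (PConf.forget : PConf T d → UConf T d) :=
  isProperMap_iff_isClosedMap_and_compact_fibers.2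
    ⟨PConf.continuous_forget, PConf.isClosedMap_forget, fun c => (PConf.finite_fiber c).isCompact⟩

theorem isOpen_setOf_sym_subset {U : Set T} (hU : IsOpen U) :
    IsOpen {c : Sym T d | ∀ x ∈ (c : Multiset T), x ∈ U} := by
  rw [← isQuotientMap_toSym.isOpen_preimage]
  have : toSym ⁻¹' {c : Sym T d | ∀ x ∈ (c : Multiset T), x ∈ U} =
      ⋂ i, (fun x : Fin d → T => x i) ⁻¹' U := by
    ext x
    simp [toSym]
  rw [this]
  exact isOpen_iInter_of_finite fun i => hU.preimage (continuous_apply i)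

/-- Disjoint open sets `U` and `V` separate the distinguished point from the others. Near `z`, the
distinguished point stays in `U` and the others stay in `V`, so the underlying configuration reveals
which point is distinguished. -/
theorem PConf.exists_nhds_injOn_forget [T2Space T] (z : PConf T d) :
    ∃ U ∈ 𝓝 z, Set.InjOn PConf.forget U := by
  classical
  have hz : z.point ∉ (z.1.1 : Multiset T) := (Multiset.nodup_cons.1 z.2.2).1
  obtain ⟨U, V, hU, hV, hzU, hzV, hUV⟩ := SeparatedNhds.of_finset_finset
    {z.point} (z.1.1 : Multiset T).toFinset (by simpa using hz)
  have hU' : IsOpen {w : PConf T d | w.point ∈ U} := hU.preimage PConf.continuous_point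
  have hV' : IsOpen {w : PConf T d | ∀ x ∈ (w.1.1 : Multiset T), x ∈ V} :=
    (isOpen_setOf_sym_subset hV).preimage (continuous_fst.comp continuous_subtype_val)
  refine ⟨_, (hU'.inter hV').mem_nhds ⟨?_, ?_⟩, ?_⟩
  · exact hzU (by simp)
  · exact fun x hx => hzV (by simpa using hx)
  · rintro w ⟨hwU, hwV⟩ w' ⟨hwU', hwV'⟩ h
    refine PConf.ext_forget_point h ?_
    have h1 : w.point ∈ (w'.forget.1 : Multiset T) := h ▸ w.point_mem_forget
    rcases Multiset.mem_cons.1 h1 with h2 | h2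
    · exact h2
    · exact (Set.disjoint_left.1 hUV hwU (hwV' _ h2)).elim

theorem continuous_symMap {T' : Type*} [TopologicalSpace T'] (g : C(T, T')) :
    Continuous (Sym.map g : Sym T d → Sym T' d) := by
  rw [isQuotientMap_toSym.continuous_iff]
  have e : (Sym.map g : Sym T d → Sym T' d) ∘ toSym = toSym ∘ fun x i => g (x i) := by
    funext x
    exact Subtype.ext (Multiset.map_map g x Finset.univ.val)
  rw [e]
  exact continuous_toSym.comp (by fun_prop)

theorem PConf.continuous_map {T' : Type*} [TopologicalSpace T'] (g : C(T, T'))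
    (hg : Function.Injective g) :
    Continuous (PConf.map g hg : PConf T d → PConf T' d) := by
  have h : Continuous fun z : PConf T d => z.1 := continuous_subtype_val
  exact (((continuous_symMap g).comp (continuous_fst.comp h)).prodMk
    (g.continuous.comp (continuous_snd.comp h))).subtype_mk _

theorem PConf.forget_map {T' : Type*} [TopologicalSpace T'] (g : C(T, T'))
    (hg : Function.Injective g) (z : PConf T d) :
    (z.map g hg).forget = UConf.map d g hg z.forget :=
  Subtype.ext (Subtype.ext (Multiset.map_cons g _ _).symm)

/-! ### The pullback of the covering -/

variable {X : Type*} [TopologicalSpace X] {F : X → UConf T d}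

theorem isLocalHomeomorph_of_isOpenMap {A B : Type*} [TopologicalSpace A] [TopologicalSpace B]
    {p : A → B} (hc : Continuous p) (ho : IsOpenMap p)
    (hi : ∀ x, ∃ U ∈ 𝓝 x, Set.InjOn p U) : IsLocalHomeomorph p := by
  rw [isLocalHomeomorph_iff_isOpenEmbedding_restrict]
  intro x
  obtain ⟨U, hU, hinj⟩ := hi x
  obtain ⟨V, hVU, hV, hxV⟩ := mem_nhds_iff.1 hU
  exact ⟨V, hV.mem_nhds hxV, .of_continuous_injective_isOpenMap (hc.comp continuous_subtype_val)
    ((hinj.mono hVU).injective) (ho.domRestrict hV)⟩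

/-- Openness is stable under base change: for `a'` near `a`, continuity of `f` puts `f a'` in the
neighbourhood `g '' V`, which supplies a second coordinate in `V`. -/
theorem isOpenMap_pullback_fst {A B C : Type*} [TopologicalSpace A] [TopologicalSpace B]
    [TopologicalSpace C] {f : A → C} {g : B → C} (hf : Continuous f) (hg : IsOpenMap g) :
    IsOpenMap (fun w : Function.Pullback f g => w.1.1) := by
  rw [isOpenMap_iff_nhds_le]
  rintro ⟨⟨a, b⟩, hab⟩
  intro S hS
  rw [Filter.mem_map, nhds_subtype_eq_comap, Filter.mem_comap] at hS
  obtain ⟨R, hR, hRS⟩ := hS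
  obtain ⟨U, hU, V, hV, hUV⟩ := mem_nhds_prod_iff.1 hR
  have hgV : g '' V ∈ 𝓝 (f a) := by
    have hab' : f a = g b := hab
    rw [hab']
    exact hg.image_mem_nhds hV
  filter_upwards [hU, hf.continuousAt.preimage_mem_nhds hgV] with a' ha' ⟨b', hb', h⟩
  exact hRS (show (⟨(a', b'), h.symm⟩ : Function.Pullback f g) ∈ Subtype.val ⁻¹' R from
    hUV ⟨ha', hb'⟩)

theorem isLocalHomeomorph_pullback_fst [T2Space T] (hF : Continuous F) :
    IsLocalHomeomorph
      (fun w : Function.Pullback F (PConf.forget : PConf T d → UConf T d) => w.1.1) := by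
  refine isLocalHomeomorph_of_isOpenMap (continuous_fst.comp continuous_subtype_val)
    (isOpenMap_pullback_fst hF PConf.isOpenMap_forget) fun w => ?_
  obtain ⟨U, hU, hinj⟩ := PConf.exists_nhds_injOn_forget w.1.2
  refine ⟨(fun w => w.1.2) ⁻¹' U,
    (continuous_snd.comp continuous_subtype_val).continuousAt.preimage_mem_nhds hU, ?_⟩
  intro v hv v' hv' h
  refine Subtype.ext (Prod.ext h (hinj hv hv' ?_))
  rw [← v.2, ← v'.2]
  exact congrArg F h

/-- The graph of `F` is compact as a continuous image of `X`, and the pullback is its preimage under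
the proper map `id × forget`. No separation property of `UConf T d` is needed. -/
theorem compactSpace_pullback [CompactSpace X] (hF : Continuous F) :
    CompactSpace (Function.Pullback F (PConf.forget : PConf T d → UConf T d)) := by
  have hK : IsCompact (Set.range fun x : X => (x, F x)) := isCompact_range (by fun_prop)
  have hP := (isProperMap_id.prodMap (PConf.isProperMap_forget (T := T) (d := d))).isCompact_preimage
    hK
  have hS : Prod.map id PConf.forget ⁻¹' (Set.range fun x : X => (x, F x)) =
      {w : X × PConf T d | F w.1 = w.2.forget} := by
    ext ⟨x, z⟩
    constructor
    · rintro ⟨y, h⟩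
      obtain ⟨rfl, h⟩ := Prod.ext_iff.1 h
      exact h
    · intro h
      exact ⟨x, Prod.ext rfl h⟩
  rw [hS] at hP
  exact isCompact_iff_compactSpace.1 hP

theorem t2Space_pullback [T2Space T] [T2Space X] :
    T2Space (Function.Pullback F (PConf.forget : PConf T d → UConf T d)) :=
  .of_injective_continuous (f := fun w => (w.1.1, w.1.2.point))
    (fun _ _ h => pullback_ext (Prod.ext_iff.1 h).1 (Prod.ext_iff.1 h).2)
    ((continuous_fst.comp continuous_subtype_val).prodMk
      (PConf.continuous_point.comp (continuous_snd.comp continuous_subtype_val)))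

end ConfigurationTopology

/-- Manifolds live in `Type`, while `T` lives in `Type u`. The pullback has finite fibres over a
type in `Type`, so it has a copy there. -/
theorem small_pullback {T : Type u} {d : ℕ} {X : Type} (F : X → UConf T d) :
    Small.{0} (Function.Pullback F (PConf.forget : PConf T d → UConf T d)) := by
  have (c : UConf T d) : Finite (PConf.forget ⁻¹' {c} : Set (PConf T d)) := PConf.finite_fiber c
  refine small_of_injective (β := Σ x : X, (PConf.forget ⁻¹' {F x} : Set (PConf T d)))
    (f := fun w => ⟨w.1.1, w.1.2, w.2.symm⟩) ?_
  rintro ⟨⟨x, z⟩, h⟩ ⟨⟨x', z'⟩, h'⟩ e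
  obtain ⟨rfl, e⟩ := Sigma.mk.inj_iff.1 e
  have := congrArg Subtype.val (eq_of_heq e)
  exact Subtype.ext (Prod.ext rfl this)

/-! ### Smooth structures on the source of a local homeomorphism -/

section LocalHomeomorph

variable {E E' : Type*} [NormedAddCommGroup E] [NormedSpace ℝ E]
  [NormedAddCommGroup E'] [NormedSpace ℝ E']
  {H H' : Type*} [TopologicalSpace H] [TopologicalSpace H']
  {I : ModelWithCorners ℝ E H} {I' : ModelWithCorners ℝ E' H'}
  {A B C : Type*} [TopologicalSpace A] [TopologicalSpace B] [TopologicalSpace C]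

variable (H) in
/-- The charts of the target of a local homeomorphism, composed with its local restrictions, are
charts of the source. -/
abbrev IsLocalHomeomorph.sourceChartedSpace [ChartedSpace H B] {p : A → B} (hp : IsLocalHomeomorph p) :
    ChartedSpace H A where
  atlas := Set.range fun x => (hp.localInverseAt x).symm.trans (chartAt H (p x))
  chartAt x := (hp.localInverseAt x).symm.trans (chartAt H (p x))
  mem_chart_source x := by simp
  chart_mem_atlas x := ⟨x, rfl⟩

/-- Passing from one lifted chart to another goes up by a local inverse of `p` and down again by
`p`, which cancel. The transition maps are therefore restrictions of those of `B`. -/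
theorem IsLocalHomeomorph.isManifold_source [ChartedSpace H B] {p : A → B} (hp : IsLocalHomeomorph p)
    (n : ℕ∞ω) [IsManifold I n B] :
    letI := hp.sourceChartedSpace H
    IsManifold I n A := by
  let := hp.sourceChartedSpace H
  refine { compatible := ?_ }
  rintro _ _ ⟨x, rfl⟩ ⟨y, rfl⟩
  set e := (hp.localInverseAt x).symm.trans (chartAt H (p x)) with he
  set e' := (hp.localInverseAt y).symm.trans (chartAt H (p y)) with he'
  have hval : ∀ h ∈ (e.symm.trans e').source,
      h ∈ (chartAt H (p x)).target ∧ p (e.symm h) = (chartAt H (p x)).symm h ∧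
        p (e.symm h) ∈ (chartAt H (p y)).source := by
    intro h hh
    simp only [he, he', OpenPartialHomeomorph.trans_source, OpenPartialHomeomorph.symm_source,
      OpenPartialHomeomorph.trans_target, Set.mem_inter_iff, Set.mem_preimage,
      IsLocalHomeomorph.localInverseAt_symm, OpenPartialHomeomorph.symm_target] at hh
    refine ⟨hh.1.1, ?_, hh.2.2⟩
    exact hp.apply_localInverseAt_of_mem hh.1.2
  have hopen : IsOpen (e.symm.trans e').source := (e.symm.trans e').open_source
  refine (contDiffGroupoid n I).mem_of_eqOnSource (closedUnderRestriction'
    (StructureGroupoid.compatible (contDiffGroupoid n I) (chart_mem_atlas H (p x))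
      (chart_mem_atlas H (p y))) hopen) ⟨?_, ?_⟩
  · rw [OpenPartialHomeomorph.restr_source, hopen.interior_eq, eq_comm, Set.inter_eq_right]
    intro h hh
    obtain ⟨h1, h2, h3⟩ := hval h hh
    exact ⟨h1, by rw [h2] at h3; exact h3⟩
  · intro h hh
    obtain ⟨h1, h2, h3⟩ := hval h hh
    have : (e.symm.trans e') h = chartAt H (p y) (p (e.symm h)) := by
      simp [he']
    rw [this, h2]
    rfl

/-- Near every point, the preferred chart is the composition of `p` with the preferred chart at the
image of the point. -/
def PreservesCharts (I : ModelWithCorners ℝ E H) [ChartedSpace H A] [ChartedSpace H B]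
    (p : A → B) : Prop :=
  ∀ x, extChartAt I x =ᶠ[𝓝 x] extChartAt I (p x) ∘ p

theorem IsLocalHomeomorph.preservesCharts [ChartedSpace H B] {p : A → B}
    (hp : IsLocalHomeomorph p) :
    letI := hp.sourceChartedSpace H
    PreservesCharts I p := by
  intro x
  refine Filter.Eventually.of_forall fun y => ?_
  change I (chartAt H (p x) ((hp.localInverseAt x).symm y)) = _
  rw [hp.localInverseAt_symm]
  rfl

namespace PreservesCharts

variable [ChartedSpace H A] [ChartedSpace H B] [ChartedSpace H' C] {p : A → B}

theorem apply_self (h : PreservesCharts I p) (x : A) :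
    extChartAt I x x = extChartAt I (p x) (p x) :=
  (h x).eq_of_nhds

/-- Whether a point lies on the boundary is read off from its image in the preferred chart, and this
image is the same for `x` and `p x`. -/
theorem isBoundaryPoint_iff (h : PreservesCharts I p) (x : A) :
    I.IsBoundaryPoint x ↔ I.IsBoundaryPoint (p x) := by
  rw [ModelWithCorners.isBoundaryPoint_iff, ModelWithCorners.isBoundaryPoint_iff, h.apply_self]

theorem boundarylessManifold (h : PreservesCharts I p) [BoundarylessManifold I B] :
    BoundarylessManifold I A where
  isInteriorPoint' x := by
    rw [ModelWithCorners.IsInteriorPoint, h.apply_self]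
    exact BoundarylessManifold.isInteriorPoint

/-- A continuous lift of a smooth map is smooth. -/
theorem contMDiffAt_lift (h : PreservesCharts I p) {n : ℕ∞ω} {g : C → A} {x : C}
    (hg : ContinuousAt g x) (hpg : ContMDiffAt I' I n (p ∘ g) x) : ContMDiffAt I' I n g x := by
  rw [contMDiffAt_iff_target] at hpg ⊢
  exact ⟨hg, hpg.2.congr_of_eventuallyEq (hg.eventually (h (g x)))⟩

theorem contMDiff (h : PreservesCharts I p) (hp : Continuous p) {n : ℕ∞ω} [IsManifold I n A] :
    ContMDiff I I n p := by
  intro x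
  rw [contMDiffAt_iff_target]
  exact ⟨hp.continuousAt, contMDiffAt_extChartAt.congr_of_eventuallyEq (h x).symm⟩

theorem mdifferentiable (h : PreservesCharts I p) (hp : Continuous p) [IsManifold I 1 A] :
    MDifferentiable I I p :=
  (h.contMDiff hp (n := 1)).mdifferentiable one_ne_zero

/-- Differentiating the germ identity between the charts at `x` gives the claim, because each
preferred chart has identity derivative at its own base point. -/
theorem chartDeriv_eq_id (h : PreservesCharts I p) (hp : Continuous p) [IsManifold I 1 A]
    [IsManifold I 1 B] (x : A) : chartDeriv I I p x = ContinuousLinearMap.id ℝ E := by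
  have h2 : MDifferentiableAt I 𝓘(ℝ, E) (extChartAt I (p x)) (p x) :=
    mdifferentiableAt_extChartAt (mem_chart_source H _)
  have h3 := chartDeriv_comp h2 (h.mdifferentiable hp x)
  have h4 : chartDeriv I 𝓘(ℝ, E) (extChartAt I x) x =
      chartDeriv I 𝓘(ℝ, E) (extChartAt I (p x) ∘ p) x := (h x).mfderiv_eq
  rw [← h4, chartDeriv_extChartAt_self, chartDeriv_extChartAt_self] at h3
  exact h3.symm

theorem chartDeriv_comp_left (h : PreservesCharts I p) (hp : Continuous p) [IsManifold I 1 A]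
    [IsManifold I 1 B] {g : C → A} {x : C} (hg : MDifferentiableAt I' I g x) :
    chartDeriv I' I (p ∘ g) x = chartDeriv I' I g x := by
  rw [chartDeriv_comp (h.mdifferentiable hp _) hg, h.chartDeriv_eq_id hp]
  rfl

theorem chartDeriv_comp_right (h : PreservesCharts I p) (hp : Continuous p) [IsManifold I 1 A]
    [IsManifold I 1 B] {g : B → C} {x : A} (hg : MDifferentiableAt I I' g (p x)) :
    chartDeriv I I' (g ∘ p) x = chartDeriv I I' g (p x) := by
  rw [chartDeriv_comp hg (h.mdifferentiable hp _), h.chartDeriv_eq_id hp]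
  rfl

theorem isLocalDiffeomorph (h : PreservesCharts I p) (hp : IsLocalHomeomorph p) {n : ℕ∞ω}
    [IsManifold I n A] : IsLocalDiffeomorph I I n p := by
  intro x
  obtain ⟨φ, hx, rfl⟩ := hp x
  refine ⟨⟨φ.toPartialEquiv, φ.open_source, φ.open_target,
    (h.contMDiff hp.continuous).contMDiffOn, fun y hy => ?_⟩, hx, fun _ _ => rfl⟩
  -- The local inverse is a continuous lift of the identity.
  refine (h.contMDiffAt_lift (φ.continuousAt_symm hy) ?_).contMDiffWithinAt
  exact contMDiffAt_id.congr_of_eventuallyEq (φ.eventually_right_inverse hy)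

/-- The orientation of the source of a local homeomorphism which is induced by an orientation of
the target. -/
def orientation (h : PreservesCharts I p) (hp : Continuous p) [IsManifold I 1 A]
    [IsManifold I 1 B] (o : ManifoldOrientation I B) : ManifoldOrientation I A where
  sign x := o.sign (p x)
  locallyConstant x := by
    -- Derivatives are compared at `y`, so the two charts must agree near `y` and not merely at it;
    -- `eventuallyEq_nhds` provides this.
    filter_upwards [hp.continuousAt.eventually (o.locallyConstant (p x)),
      hp.continuousAt.preimage_mem_nhds ((chartAt H (p x)).open_source.mem_nhds
        (mem_chart_source H (p x))), (h x).eventuallyEq_nhds] with y hy hy' hy''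
    have h4 : chartDeriv I 𝓘(ℝ, E) (extChartAt I x) y =
      chartDeriv I 𝓘(ℝ, E) (extChartAt I (p x) ∘ p) y := hy''.mfderiv_eq
    rw [h4, h.chartDeriv_comp_right hp (mdifferentiableAt_extChartAt hy')]
    exact hy

theorem sumMap {A' B' : Type*} [TopologicalSpace A'] [TopologicalSpace B'] [ChartedSpace H A']
    [ChartedSpace H B'] {p' : A' → B'} (h : PreservesCharts I p) (h' : PreservesCharts I p') :
    PreservesCharts I (Sum.map p p') := by
  rintro (x | x)
  · rw [Filter.EventuallyEq, nhds_inl, Filter.eventually_map]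
    filter_upwards [h x] with y hy
    rw [extChartAt_inl_apply, hy]
    exact extChartAt_inl_apply.symm
  · rw [Filter.EventuallyEq, nhds_inr, Filter.eventually_map]
    filter_upwards [h' x] with y hy
    rw [extChartAt_inr_apply, hy]
    exact extChartAt_inr_apply.symm

end PreservesCharts

/-- A continuous lift of a smooth map through a local diffeomorphism is smooth. -/
theorem IsLocalDiffeomorph.contMDiff_lift [ChartedSpace H A] [ChartedSpace H B]
    [ChartedSpace H' C] {n : ℕ∞ω} {p : A → B} (hp : IsLocalDiffeomorph I I n p) {g : C → A}
    (hg : Continuous g) (hpg : ContMDiff I' I n (p ∘ g)) : ContMDiff I' I n g := by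
  intro x
  have hx := hp (g x)
  refine (hx.localInverse_contMDiffAt.comp x (hpg x)).congr_of_eventuallyEq ?_
  filter_upwards [hg.continuousAt.eventually hx.localInverse_eventuallyEq_left] with y hy
  exact hy.symm

end LocalHomeomorph

/-! ### The covering of pointed configurations, with its smooth structure -/

section ConfCover

variable {T : Type u} {d : ℕ} {X : Type}

instance (F : X → UConf T d) :
    Small.{0} (Function.Pullback F (PConf.forget : PConf T d → UConf T d)) :=
  small_pullback F

variable [TopologicalSpace T] [TopologicalSpace X]

/-- The pullback of the covering of pointed configurations, as a type in the lowest universe. -/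
def ConfCover (F : C(X, UConf T d)) : Type :=
  Shrink.{0} (Function.Pullback F (PConf.forget : PConf T d → UConf T d))

namespace ConfCover

variable (F : C(X, UConf T d))

instance : TopologicalSpace (ConfCover F) :=
  inferInstanceAs (TopologicalSpace (Shrink.{0} (Function.Pullback F PConf.forget)))

/-- The homeomorphism to the pullback. -/
def homeomorph : ConfCover F ≃ₜ Function.Pullback F (PConf.forget : PConf T d → UConf T d) :=
  (Shrink.homeomorph _).symm

/-- The projection to the base. -/
def proj (w : ConfCover F) : X := (homeomorph F w).1.1

/-- The distinguished point. -/
def point (w : ConfCover F) : T := (homeomorph F w).1.2.point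

theorem continuous_point : Continuous (point F) :=
  PConf.continuous_point.comp
    (continuous_snd.comp (continuous_subtype_val.comp (homeomorph F).continuous))

variable {F} in
theorem ext {v w : ConfCover F} (h : proj F v = proj F w) (h' : point F v = point F w) : v = w :=
  (homeomorph F).injective (pullback_ext h h')

instance [CompactSpace X] : CompactSpace (ConfCover F) :=
  haveI := compactSpace_pullback F.continuous
  (homeomorph F).symm.compactSpace

/-! ### Maps of coverings over maps of the bases -/

section Lift

variable {F} {Y : Type} [TopologicalSpace Y]

/-- The map of coverings over a map `j` of the bases. -/
def lift {G : C(Y, UConf T d)} (j : Y → X) (hj : ∀ y, F (j y) = G y) (w : ConfCover G) :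
    ConfCover F :=
  (homeomorph F).symm
    ⟨(j (homeomorph G w).1.1, (homeomorph G w).1.2), (hj _).trans (homeomorph G w).2⟩

variable {G : C(Y, UConf T d)} {j : Y → X} (hj : ∀ y, F (j y) = G y)

theorem homeomorph_lift (w : ConfCover G) : homeomorph F (lift j hj w) =
    ⟨(j (homeomorph G w).1.1, (homeomorph G w).1.2), (hj _).trans (homeomorph G w).2⟩ :=
  (homeomorph F).apply_symm_apply _

theorem proj_comp_lift : proj F ∘ lift j hj = j ∘ proj G := by
  funext w
  simp only [Function.comp, proj, homeomorph_lift]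

theorem proj_lift (w : ConfCover G) : proj F (lift j hj w) = j (proj G w) :=
  congrFun (proj_comp_lift hj) w

theorem point_lift (w : ConfCover G) : point F (lift j hj w) = point G w := by
  simp only [point, homeomorph_lift]

theorem continuous_lift (hjc : Continuous j) : Continuous (lift (F := F) j hj) := by
  refine (homeomorph F).symm.continuous.comp (Continuous.subtype_mk ?_ _)
  have h := continuous_subtype_val.comp (homeomorph G).continuous
  exact (hjc.comp (continuous_fst.comp h)).prodMk (continuous_snd.comp h)

theorem lift_injective (hji : Function.Injective j) : Function.Injective (lift (F := F) j hj) := by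
  intro v w h
  refine ext (hji ?_) ?_
  · rw [← proj_lift hj, ← proj_lift hj, h]
  · rw [← point_lift hj, ← point_lift hj, h]

/-- The covering over `Y` is the full preimage of `j(Y)`, because `lift` leaves the pointed
configuration unchanged. Applied to the ends of a bordism, this determines the boundary of its
covering. -/
theorem mem_range_lift {w : ConfCover F} :
    w ∈ Set.range (lift (F := F) (G := G) j hj) ↔ proj F w ∈ Set.range j := by
  constructor
  · rintro ⟨v, rfl⟩
    exact ⟨_, (proj_lift hj v).symm⟩
  · rintro ⟨y, hy⟩
    have hw : G y = (homeomorph F w).1.2.forget := by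
      rw [← hj, hy]
      exact (homeomorph F w).2
    refine ⟨(homeomorph G).symm ⟨(y, (homeomorph F w).1.2), hw⟩, ext ?_ ?_⟩
    · rw [proj_lift, ← hy]
      simp [proj]
    · rw [point_lift]
      simp [point]

end Lift

variable [T2Space T]

instance [T2Space X] : T2Space (ConfCover F) :=
  haveI := t2Space_pullback (F := F)
  (homeomorph F).symm.t2Space

theorem isLocalHomeomorph_proj : IsLocalHomeomorph (proj F) :=
  (isLocalHomeomorph_pullback_fst F.continuous).comp (homeomorph F).isLocalHomeomorph

theorem continuous_proj : Continuous (proj F) := (isLocalHomeomorph_proj F).continuous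

section Charts

variable {E H : Type*} [NormedAddCommGroup E] [NormedSpace ℝ E] [TopologicalSpace H]
  [ChartedSpace H X]

instance : ChartedSpace H (ConfCover F) := (isLocalHomeomorph_proj F).sourceChartedSpace H

instance (I : ModelWithCorners ℝ E H) (n : ℕ∞ω) [IsManifold I n X] :
    IsManifold I n (ConfCover F) :=
  (isLocalHomeomorph_proj F).isManifold_source n

theorem preservesCharts_proj (I : ModelWithCorners ℝ E H) : PreservesCharts I (proj F) :=
  (isLocalHomeomorph_proj F).preservesCharts

end Charts

variable {F} {Y : Type} [TopologicalSpace Y] {G : C(Y, UConf T d)} {j : Y → X}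
  (hj : ∀ y, F (j y) = G y)
  {E E' H H' : Type*} [NormedAddCommGroup E] [NormedSpace ℝ E] [TopologicalSpace H]
  [NormedAddCommGroup E'] [NormedSpace ℝ E'] [TopologicalSpace H']
  [ChartedSpace H X] [ChartedSpace H' Y]
  {I : ModelWithCorners ℝ E H} {I' : ModelWithCorners ℝ E' H'}

theorem contMDiff_lift {n : ℕ∞ω} [IsManifold I' n Y] (hjs : ContMDiff I' I n j) :
    ContMDiff I' I n (lift (F := F) j hj) := by
  intro w
  refine (preservesCharts_proj F I).contMDiffAt_lift
    (continuous_lift hj hjs.continuous).continuousAt ?_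
  rw [proj_comp_lift]
  exact (hjs.comp ((preservesCharts_proj G I').contMDiff (continuous_proj G))) w

/-- Both projections have identity derivative, so differentiating `proj ∘ lift = j ∘ proj` leaves
the derivative of `j`. -/
theorem chartDeriv_lift [IsManifold I 1 X] [IsManifold I' 1 Y] (hjs : ContMDiff I' I 1 j)
    (w : ConfCover G) :
    chartDeriv I' I (lift (F := F) j hj) w = chartDeriv I' I j (proj G w) := by
  rw [← (preservesCharts_proj F I).chartDeriv_comp_left (continuous_proj F)
    ((contMDiff_lift hj hjs).mdifferentiable one_ne_zero w), proj_comp_lift,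
    (preservesCharts_proj G I').chartDeriv_comp_right (continuous_proj G)
      (hjs.mdifferentiable one_ne_zero _)]

end ConfCover

end ConfCover

/-! ### Tracings -/

section Tracing

variable {T : Type u} [TopologicalSpace T] {d k : ℕ}

/-- Two out of three for orientations: if a composite and its outer map preserve orientation, so
does the inner map. Here `r` is the determinant of the outer map and `q` that of the inner one. -/
theorem units_smul_pos_of_mul {a b c : ℤˣ} {r q : ℝ} (h : 0 < (a * c) • (r * q))
    (h' : 0 < (b * c) • r) : 0 < (a * b) • q := by
  rcases Int.units_eq_one_or a with rfl | rfl <;> rcases Int.units_eq_one_or b with rfl | rfl <;>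
    rcases Int.units_eq_one_or c with rfl | rfl <;>
    simp [Units.smul_def] at h h' ⊢ <;>
    nlinarith

/-- A tracing is unique up to bordism. -/
theorem IsTracing.bordant {s : OrientedSingularManifold k (UConf T d)}
    {t t' : OrientedSingularManifold k T} (h : IsTracing s t) (h' : IsTracing s t') :
    Bordant t t' := by
  obtain ⟨e, he, heo, hef⟩ := h
  obtain ⟨e', he', heo', hef'⟩ := h'
  set p : t.M → s.M := fun y => (e y).1.1 with hp
  set p' : t'.M → s.M := fun y => (e' y).1.1 with hp'
  let φ : t'.M ≃ₜ t.M := e'.trans e.symm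
  have hφ : p ∘ φ = p' := by
    funext y
    simp [hp, hp', φ]
  have hφ' : p' ∘ φ.symm = p := by
    funext y
    simp [hp, hp', φ]
  -- The comparison map and its inverse lift the smooth projections `p'` and `p` through local
  -- diffeomorphisms, so both are smooth.
  have hs : ContMDiff (𝓡 k) (𝓡 k) ∞ φ :=
    he.contMDiff_lift φ.continuous (hφ ▸ he'.contMDiff)
  have hs' : ContMDiff (𝓡 k) (𝓡 k) ∞ φ.symm :=
    he'.contMDiff_lift φ.symm.continuous (hφ' ▸ he.contMDiff)
  refine Bordant.of_diffeomorph ⟨φ.toEquiv, hs, hs'⟩ (fun y => ?_) fun y => ?_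
  · change t.f (φ y) = _
    rw [hef, hef']
    simp [φ]
  · change 0 < (t'.orientation.sign y * t.orientation.sign (φ y)) • (chartDeriv (𝓡 k) (𝓡 k) φ y).det
    have h1 := heo (φ y)
    have h2 := heo' y
    have h3 : (chartDeriv (𝓡 k) (𝓡 k) p' y).det =
        (chartDeriv (𝓡 k) (𝓡 k) p (φ y)).det * (chartDeriv (𝓡 k) (𝓡 k) φ y).det := by
      rw [← hφ, chartDeriv_comp (he.mdifferentiable (by simp) _) (hs.mdifferentiable (by simp) _)]
      exact LinearMap.det_comp _ _
    have h4 : (e (φ y)).1.1 = (e' y).1.1 := congrFun hφ y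
    rw [h3] at h2
    rw [h4] at h1
    exact units_smul_pos_of_mul h2 h1

variable [T2Space T]

/-- The oriented singular manifold `(M̃, f̃)`. -/
def OrientedSingularManifold.tracing (s : OrientedSingularManifold k (UConf T d)) :
    OrientedSingularManifold k T where
  M := ConfCover ⟨s.f, s.hf⟩
  boundaryless := (ConfCover.preservesCharts_proj ⟨s.f, s.hf⟩ (𝓡 k)).boundarylessManifold
  f := ConfCover.point ⟨s.f, s.hf⟩
  hf := ConfCover.continuous_point _
  orientation := (ConfCover.preservesCharts_proj ⟨s.f, s.hf⟩ (𝓡 k)).orientation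
    (ConfCover.continuous_proj _) s.orientation

/-- A criterion for recognizing tracings. A continuous bijection from a compact space to a Hausdorff
space is a homeomorphism, and chart preservation makes the projection a local diffeomorphism with
identity derivative, so orientations agree as soon as the signs do. -/
theorem IsTracing.of_preservesCharts {s : OrientedSingularManifold k (UConf T d)}
    {t : OrientedSingularManifold k T}
    (q : t.M → Function.Pullback s.f (PConf.forget : PConf T d → UConf T d))
    (hq : Continuous q) (hqb : Function.Bijective q)
    (hcharts : PreservesCharts (𝓡 k) fun y => (q y).1.1)
    (hsign : ∀ y, t.orientation.sign y = s.orientation.sign (q y).1.1)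
    (hf : ∀ y, t.f y = (q y).1.2.point) : IsTracing s t := by
  have := t2Space_pullback (F := s.f)
  let e : t.M ≃ₜ Function.Pullback s.f (PConf.forget : PConf T d → UConf T d) :=
    Continuous.homeoOfEquivCompactToT2 (f := Equiv.ofBijective q hqb) hq
  have hp : IsLocalHomeomorph fun y => (q y).1.1 :=
    (isLocalHomeomorph_pullback_fst s.hf).comp e.isLocalHomeomorph
  refine ⟨e, hcharts.isLocalDiffeomorph hp, fun y => ?_, hf⟩
  rw [hsign]
  exact det_chartDeriv_pos_of_eq_id _ (hcharts.chartDeriv_eq_id hp.continuous y)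

theorem OrientedSingularManifold.isTracing_tracing (s : OrientedSingularManifold k (UConf T d)) :
    IsTracing s s.tracing :=
  .of_preservesCharts (t := s.tracing) (ConfCover.homeomorph ⟨s.f, s.hf⟩)
    (ConfCover.homeomorph _).continuous (ConfCover.homeomorph _).bijective
    (ConfCover.preservesCharts_proj _ (𝓡 k)) (fun _ => rfl) (fun _ => rfl)

/-- The lift has the derivative of `j`, and the signs are pulled back along the projections. The
condition at `w` is thus the condition for `j` at the projection of `w`. -/
theorem IsOrientedBoundaryMap.confCover_lift {M W : Type} [TopologicalSpace M]
    [ChartedSpace (EuclideanSpace ℝ (Fin k)) M] [IsManifold (𝓡 k) 1 M] [TopologicalSpace W]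
    [ChartedSpace (ModelProd (EuclideanHalfSpace 1) (EuclideanSpace ℝ (Fin k))) W]
    [IsManifold (halfSpaceModel k) 1 W]
    {o : ManifoldOrientation (𝓡 k) M} {o' : ManifoldOrientation (halfSpaceModel k) W} {j : M → W}
    (h : IsOrientedBoundaryMap o o' j) (hjs : ContMDiff (𝓡 k) (halfSpaceModel k) 1 j)
    {F : C(W, UConf T d)} {G : C(M, UConf T d)} (hj : ∀ y, F (j y) = G y) :
    IsOrientedBoundaryMap
      ((ConfCover.preservesCharts_proj G (𝓡 k)).orientation (ConfCover.continuous_proj G) o)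
      ((ConfCover.preservesCharts_proj F (halfSpaceModel k)).orientation
        (ConfCover.continuous_proj F) o') (ConfCover.lift (F := F) j hj) := by
  intro w
  rw [ConfCover.chartDeriv_lift hj hjs]
  change 0 < (o.sign _ * o'.sign (ConfCover.proj F (ConfCover.lift j hj w))) • _
  rw [ConfCover.proj_lift]
  exact h _

/-- The tracings of bordant singular manifolds are bordant. -/
theorem Bordant.tracing {s t : OrientedSingularManifold k (UConf T d)} (h : Bordant s t) :
    Bordant s.tracing t.tracing := by
  obtain ⟨b⟩ := h
  let F : C(b.W, UConf T d) := ⟨b.F, b.continuous_F⟩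
  have hl : ∀ y, F (b.left y) = (⟨s.f, s.hf⟩ : C(s.M, UConf T d)) y := b.F_left
  have hr : ∀ y, F (b.right y) = (⟨t.f, t.hf⟩ : C(t.M, UConf T d)) y := b.F_right
  have hinj := Sum.elim_injective.1 b.injective
  refine ⟨{
    W := ConfCover F
    orientation := (ConfCover.preservesCharts_proj F (halfSpaceModel k)).orientation
      (ConfCover.continuous_proj F) b.orientation
    F := ConfCover.point F
    continuous_F := ConfCover.continuous_point F
    left := ConfCover.lift b.left hl
    right := ConfCover.lift b.right hr
    contMDiff_left := ConfCover.contMDiff_lift hl b.contMDiff_left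
    contMDiff_right := ConfCover.contMDiff_lift hr b.contMDiff_right
    injective := ?_
    range_eq := ?_
    F_left := ConfCover.point_lift hl
    F_right := ConfCover.point_lift hr
    oriented_left := b.oriented_left.confCover_lift (b.contMDiff_left.of_le (by simp)) hl
    oriented_right := b.oriented_right.confCover_lift (b.contMDiff_right.of_le (by simp)) hr }⟩
  · refine Sum.elim_injective.2
      ⟨ConfCover.lift_injective hl hinj.1, ConfCover.lift_injective hr hinj.2.1, fun v w h => ?_⟩
    exact hinj.2.2 _ _ ((ConfCover.proj_lift hl v).symm.trans
      ((congrArg (ConfCover.proj F) h).trans (ConfCover.proj_lift hr w)))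
  -- The ranges of the lifts are the preimages of the two ends of `W`, which together form its
  -- boundary; the projection preserves and reflects boundary points.
  · have hb := b.range_eq
    rw [Set.Sum.elim_range] at hb
    refine (Set.Sum.elim_range _ _).trans (Set.ext fun w => ?_)
    refine (or_congr (ConfCover.mem_range_lift hl) (ConfCover.mem_range_lift hr)).trans ?_
    rw [← Set.mem_union, hb]
    exact ((ConfCover.preservesCharts_proj F (halfSpaceModel k)).isBoundaryPoint_iff w).symm

/-- The pullback over a disjoint union is the disjoint union of the pullbacks; `a` and `b` are the
inclusions of the two pieces. -/
theorem isTracing_sum (s t : OrientedSingularManifold k (UConf T d)) :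
    IsTracing (s.sum t) (s.tracing.sum t.tracing) := by
  let F : C(s.M, UConf T d) := ⟨s.f, s.hf⟩
  let G : C(t.M, UConf T d) := ⟨t.f, t.hf⟩
  let a : ConfCover F → Function.Pullback (Sum.elim s.f t.f) (PConf.forget : PConf T d → _) :=
    fun w => ⟨(Sum.inl (ConfCover.homeomorph F w).1.1, (ConfCover.homeomorph F w).1.2),
      (ConfCover.homeomorph F w).2⟩
  let b : ConfCover G → Function.Pullback (Sum.elim s.f t.f) (PConf.forget : PConf T d → _) :=
    fun w => ⟨(Sum.inr (ConfCover.homeomorph G w).1.1, (ConfCover.homeomorph G w).1.2),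
      (ConfCover.homeomorph G w).2⟩
  have hF := continuous_subtype_val.comp (ConfCover.homeomorph F).continuous
  have hG := continuous_subtype_val.comp (ConfCover.homeomorph G).continuous
  have ha : Continuous a := ((continuous_inl.comp (continuous_fst.comp hF)).prodMk
    (continuous_snd.comp hF)).subtype_mk _
  have hb : Continuous b := ((continuous_inr.comp (continuous_fst.comp hG)).prodMk
    (continuous_snd.comp hG)).subtype_mk _
  refine .of_preservesCharts (s := s.sum t) (t := s.tracing.sum t.tracing) (Sum.elim a b)
    (ha.sumElim hb) ⟨Sum.elim_injective.2 ⟨?_, ?_, ?_⟩, ?_⟩ ?_ ?_ ?_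
  · intro v w h
    have h' := Prod.ext_iff.1 (congrArg Subtype.val h)
    exact ConfCover.ext (Sum.inl_injective h'.1) (congrArg PConf.point h'.2)
  · intro v w h
    have h' := Prod.ext_iff.1 (congrArg Subtype.val h)
    exact ConfCover.ext (Sum.inr_injective h'.1) (congrArg PConf.point h'.2)
  · intro v w h
    exact Sum.inl_ne_inr (Prod.ext_iff.1 (congrArg Subtype.val h)).1
  · rintro ⟨⟨y | y, z⟩, h⟩
    · refine ⟨Sum.inl ((ConfCover.homeomorph F).symm ⟨(y, z), h⟩), Subtype.ext ?_⟩
      exact congrArg (fun v => (Sum.inl v.1.1, v.1.2))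
        ((ConfCover.homeomorph F).apply_symm_apply ⟨(y, z), h⟩)
    · refine ⟨Sum.inr ((ConfCover.homeomorph G).symm ⟨(y, z), h⟩), Subtype.ext ?_⟩
      exact congrArg (fun v => (Sum.inr v.1.1, v.1.2))
        ((ConfCover.homeomorph G).apply_symm_apply ⟨(y, z), h⟩)
  · have h := (ConfCover.preservesCharts_proj F (𝓡 k)).sumMap
      (ConfCover.preservesCharts_proj G (𝓡 k))
    have e : Sum.map (ConfCover.proj F) (ConfCover.proj G) = fun y => (Sum.elim a b y).1.1 := by
      funext y
      rcases y with y | y <;> rfl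
    rw [e] at h
    exact h
  · rintro (y | y) <;> rfl
  · rintro (y | y) <;> rfl

/-- For injective `g`, distinguishing a point of `g(c)` amounts to distinguishing a point of `c`.
Both coverings of `s.M` therefore agree, with the same charts and signs, and only the map to the
target is composed with `g`. -/
theorem isTracing_map {T' : Type u} [TopologicalSpace T'] [T2Space T']
    (s : OrientedSingularManifold k (UConf T d)) (g : C(T, T')) (hg : Function.Injective g) :
    IsTracing (s.map (UConf.map d g hg)) (s.tracing.map g) := by
  let F : C(s.M, UConf T d) := ⟨s.f, s.hf⟩
  let q : ConfCover F →
      Function.Pullback (UConf.map d g hg ∘ s.f) (PConf.forget : PConf T' d → _) :=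
    fun w => ⟨((ConfCover.homeomorph F w).1.1, (ConfCover.homeomorph F w).1.2.map g hg), by
      rw [PConf.forget_map, ← (ConfCover.homeomorph F w).2]
      rfl⟩
  have hF := continuous_subtype_val.comp (ConfCover.homeomorph F).continuous
  have hq : Continuous q := ((continuous_fst.comp hF).prodMk
    ((PConf.continuous_map g hg).comp (continuous_snd.comp hF))).subtype_mk _
  refine .of_preservesCharts (s := s.map (UConf.map d g hg)) (t := s.tracing.map g) q hq
    ⟨?_, ?_⟩ (ConfCover.preservesCharts_proj F (𝓡 k)) (fun _ => rfl) (fun _ => rfl)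
  · intro v w h
    have h' := Prod.ext_iff.1 (congrArg Subtype.val h)
    exact ConfCover.ext h'.1 (hg (congrArg PConf.point h'.2))
  · rintro ⟨⟨y, z⟩, h⟩
    -- For surjectivity, the distinguished point of `z` belongs to the image configuration, so it
    -- comes from a point of `s.f y`.
    have hz : z.point ∈ ((s.f y).1 : Multiset T).map g := by
      have h' : UConf.map d g hg (s.f y) = z.forget := h
      have := z.point_mem_forget
      rw [← h'] at this
      exact this
    obtain ⟨x, hx, hxz⟩ := Multiset.mem_map.1 hz
    obtain ⟨w, hw, rfl⟩ := PConf.exists_forget_eq hx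
    refine ⟨(ConfCover.homeomorph F).symm ⟨(y, w), hw.symm⟩, pullback_ext ?_ ?_⟩
    · exact congrArg (fun v => v.1.1) ((ConfCover.homeomorph F).apply_symm_apply ⟨(y, w), hw.symm⟩)
    · simp only [q, Homeomorph.apply_symm_apply]
      exact hxz

end Tracing

end

/-! ### The transfer homomorphism -/

theorem mainTheorem6 (d k : ℕ) :
    ∃ tr : ∀ (T : Type u) [TopologicalSpace T] [T2Space T],
        OrientedBordismGroup k (UConf T d) →+ OrientedBordismGroup k T,
      (∀ (T : Type u) [TopologicalSpace T] [T2Space T]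
        (s : OrientedSingularManifold k (UConf T d)),
        (∃ t : OrientedSingularManifold k T, IsTracing s t) ∧
        ∀ t : OrientedSingularManifold k T, IsTracing s t →
          tr T (bordismClass s) = bordismClass t) ∧
      (∀ (T T' : Type u) [TopologicalSpace T] [T2Space T] [TopologicalSpace T'] [T2Space T']
        (g : C(T, T')) (hg : Function.Injective g),
        (bordismMap k g).comp (tr T) = (tr T').comp (bordismMap k (UConf.map d g hg))) := by
  refine ⟨fun T _ _ => AddMonoidHom.mk'
    (Quot.map OrientedSingularManifold.tracing fun _ _ h => h.tracing) ?_, ?_, ?_⟩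
  · rintro ⟨s⟩ ⟨t⟩
    -- Both the tracing of the sum and the sum of the tracings are tracings of `s.sum t`, hence
    -- bordant.
    exact Quot.sound ((s.sum t).isTracing_tracing.bordant (isTracing_sum s t))
  · intro T _ _ s
    exact ⟨⟨_, s.isTracing_tracing⟩, fun t ht => Quot.sound (s.isTracing_tracing.bordant ht)⟩
  · intro T T' _ _ _ _ g hg
    refine AddMonoidHom.ext ?_
    rintro ⟨s⟩
    -- Both sides are represented by tracings of the pushforward of `s` along `UConf.map d g hg`.
    exact Quot.sound ((isTracing_map s g hg).bordant (s.map _).isTracing_tracing)
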